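/- Let $p$ be a prime, $\overline{\mathbb F}_p$ an algebraic closure of $\mathbb F_p$, $G=\mathrm{GL}_2(\mathbb Q_p)$ with centre $Z$, $K=\mathrm{GL}_2(\mathbb Z_p)$, and $I\subset K$ the Iwahori subgroup of matrices that are upper triangular mod $p$. Let $\alpha=\begin{pmatrix}1&0\\0&p\end{pmatrix}$, $\beta=\begin{pmatrix}0&1\\p&0\end{pmatrix}$, and let $[x]\in\mathbb Z_p$ denote the Teichmüller representative of $x\in\mathbb F_p$. All representations are over $\overline{\mathbb F}_p$. For $0\le r\le p-1$ let $V_r$ be the space of homogeneous polynomials of degree $r$ in $X,Y$, on which $\begin{pmatrix}a&b\\c&d\end{pmatrix}\in K$ acts by $P(X,Y)\mapsto P(aX+cY,bX+dY)$ and the scalar matrix $p$ acts trivially. Let $d^r$ be the character of $IZ$ with $\begin{pmatrix}a&b\\c&d\end{pmatrix}\mapsto d^r \bmod p$ on $I$ and $p\mapsto 1$. For $H=KZ$ or $IZ$ let $\mathrm{ind}_H^G\sigma$ be the compact induction, and let $[g,v]$ (for $H=KZ$), resp. $[[g,v]]$ (for $H=IZ$), be the function supported on $Hg^{-1}$ with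 value $\sigma(h)v$ at $hg^{-1}$. Let $T$ be the $G$-endomorphism of $\mathrm{ind}_{KZ}^G V_r$ with $$T[1,P]=\sum_{x\in\mathbb F_p}\left[\begin{pmatrix}p&[x]\\0&1\end{pmatrix},P(X,-xX+pY)\right]+[\alpha,P(pX,Y)],$$ and let $T_{-1,0},T_{1,2}$ be the $G$-endomorphisms of $\mathrm{ind}_{IZ}^G d^r$ with $$T_{-1,0}[[1,1]]=\sum_{x\in\mathbb F_p}\left[\left[\begin{pmatrix}p&[x]\\0&1\end{pmatrix},1\right]\right],\qquad T_{1,2}[[1,1]]=\sum_{x\in\mathbb F_p}\left[\left[\begin{pmatrix}1&0\\p[x]&p\end{pmatrix},1\right]\right];$$ when $r\in\{0,p-1\}$ let moreover $T_{1,0}[[1,1]]=[[\beta,1]]$. Let $\delta_{a,b}$ be $1$ if $a=b$ and $0$ otherwise (a term $0\cdot T_{1,0}$ is read as $0$), and for operators $A,B$ let $(A)+(B)$ denote the sum of their images. For $\lambda\in\overline{\mathbb F}_p$ and a smooth character $\eta:\mathbb Q_p^*\to\overline{\mathbb F}_p^*$ put $$\pi(r,\lambda,\eta)=\frac{\mathrm{ind}_{KZ}^G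 V_r}{(T-\lambda)}\otimes(\eta\circ\det),\qquad \Pi(r,\lambda,\eta)=\frac{\mathrm{ind}_{IZ}^G d^r}{(T_{-1,0}+\delta_{r,p-1}T_{1,0})+(T_{1,2}+\delta_{r,0}T_{1,0}-\lambda)}\otimes(\eta\circ\det).$$ On the Galois side, let $\omega$ be the mod $p$ cyclotomic character of $\mathrm{Gal}(\overline{\mathbb Q}_p/\mathbb Q_p)$, $\omega_2$ the fundamental character of level $2$ of inertia, $\mathrm{ind}(\omega_2^c)$ the representation induced from an extension of $\omega_2^c$ to $\mathrm{Gal}(\overline{\mathbb Q}_p/\mathbb Q_{p^2})$ chosen such that the induced representation has determinant $\omega^c$, and $\mu_a$ the unramified character sending geometric Frobenius elements to $a$. Characters of $\mathbb Q_p^*$ and of $\mathrm{Gal}(\overline{\mathbb Q}_p/\mathbb Q_p)$ are identified by local class field theory with uniformisers corresponding to geometric Frobenius elements, so that $\omega$ becomes the character of $\mathbb Q_p^*$ with $p\mapsto1$ and $u\mapsto u\bmod p$ for $u\in\mathbb Z_p^*$. Let $[a]\in\{0,\dots,p-2\}$ be the class of an integer $a$ mod $p-1$, and let $(\cdot)^{\mathrm{ss}}$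 denote semisimplification. Breuil's semisimple mod $p$ local Langlands correspondence is $$(\mathrm{ind}\,\omega_2^{r+1})\otimes\eta\longleftrightarrow\pi(r,0,\eta)\qquad(\lambda=0),$$ $$(\mu_\lambda\omega^{r+1}\oplus\mu_{\lambda^{-1}})\otimes\eta\longleftrightarrow\pi(r,\lambda,\eta)^{\mathrm{ss}}\oplus\pi([p-3-r],\lambda^{-1},\eta\omega^{r+1})^{\mathrm{ss}}\qquad(\lambda\ne0).$$ **Theorem.** For every $r\in\{0,\dots,p-1\}$, every $\lambda\in\overline{\mathbb F}_p$ and every smooth character $\eta:\mathbb Q_p^*\to\overline{\mathbb F}_p^*$ there is an isomorphism of $G$-representations $\pi(r,\lambda,\eta)\cong\Pi(r,\lambda,\eta)$. Consequently, for each $(r,\lambda,\eta)$, Breuil's correspondence coincides (as a relation between isomorphism classes of representations of $\mathrm{Gal}(\overline{\mathbb Q}_p/\mathbb Q_p)$ and of $G$) with the Iwahori-theoretic correspondence $$(\mathrm{ind}\,\omega_2^{r+1})\otimes\eta\longleftrightarrow\Pi(r,0,\eta)\qquad(\lambda=0),$$ $$(\mu_\lambda\omega^{r+1}\oplus\mu_{\lambda^{-1}})\otimes\eta\longleftrightarrow\Pi(r,\lambda,\eta)^{\mathrm{ss}}\oplus\Pi([p-3-r],\lambda^{-1},\eta\omega^{r+1})^{\mathrm{ss}}\qquad(\lambda\ne0).$$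 -/

import Mathlib

noncomputable section

namespace ModpLLC

section General

variable {k Γ V W : Type*} [Field k] [Group Γ] [AddCommGroup V] [Module k V]
  [AddCommGroup W] [Module k W]

/-- The twist `ρ ⊗ χ` of a representation by a `kˣ`-valued character, realised on the space
of `ρ`. -/
def twist (χ : Γ →* kˣ) (ρ : Representation k Γ V) : Representation k Γ V where
  toFun g := (χ g : k) • ρ g
  map_one' := by simp
  map_mul' g h := by
    ext v
    simp [smul_smul, mul_comm]

/-- A character as a representation on the line `k`. -/
def charRep (χ : Γ →* kˣ) : Representation k Γ k := twist χ (Representation.trivial k Γ k)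

/-- The quotient of a representation by a subrepresentation. -/
def quotRep {ρ : Representation k Γ V} (U : Subrepresentation ρ) :
    Representation k Γ (V ⧸ U.toSubmodule) :=
  ρ.quotient U.toSubmodule fun g _ hv => U.apply_mem_toSubmodule g hv

/-- The direct sum of the successive quotients of a composition series of `k[Γ]`-modules. -/
abbrev Gr {M : Type*} [AddCommGroup M] [Module (MonoidAlgebra k Γ) M]
    (s : CompositionSeries (Submodule (MonoidAlgebra k Γ) M)) : Type _ :=
  (i : Fin s.length) → (s i.succ ⧸ (s i.castSucc).submoduleOf (s i.succ))

/-- `Π ≅ ρ^ss ⊕ ρ'^ss`: here `ρ^ss` is the direct sum of the Jordan–Hölder factors of `ρ`, that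
is, of the simple successive quotients of a composition series from `0` to the whole space
(for representations of finite length it does not depend on the series). -/
def IsSumOfSemisimplifications {U : Type*} [AddCommGroup U] [Module k U]
    (P : Representation k Γ U) (ρ : Representation k Γ V) (ρ' : Representation k Γ W) : Prop :=
  ∃ (s : CompositionSeries (Submodule (MonoidAlgebra k Γ) ρ.asModule))
    (s' : CompositionSeries (Submodule (MonoidAlgebra k Γ) ρ'.asModule)),
    s.head = ⊥ ∧ s.last = ⊤ ∧ s'.head = ⊥ ∧ s'.last = ⊤ ∧
    Nonempty (P.asModule ≃ₗ[MonoidAlgebra k Γ] (Gr s × Gr s'))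

/-! ### Compact induction -/

variable (H : Subgroup Γ) (σ : Representation k H V)

/-- The space of the compact induction `ind_H^Γ σ` (for `H` an open subgroup and `σ` a smooth
representation): functions `f : Γ → V` with `f (h g) = σ(h) f(g)` whose support is contained in a
finite union of cosets `H s`. -/
def cIndSub : Submodule k (Γ → V) where
  carrier := {f | (∀ (h : H) (g : Γ), f (h * g) = σ h (f g)) ∧
    ∃ S : Finset Γ, ∀ g, f g ≠ 0 → ∃ h ∈ H, ∃ s ∈ S, g = h * s}
  add_mem' := by
    classical
    rintro f f' ⟨e, S, hS⟩ ⟨e', S', hS'⟩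
    refine ⟨fun h g => by simp [e, e'], S ∪ S', fun g hg => ?_⟩
    by_cases h0 : f g = 0
    · have : f' g ≠ 0 := by
        intro h1
        apply hg
        simp [h0, h1]
      obtain ⟨h, hh, s, hs, e⟩ := hS' g this
      exact ⟨h, hh, s, Finset.mem_union_right _ hs, e⟩
    · obtain ⟨h, hh, s, hs, e⟩ := hS g h0
      exact ⟨h, hh, s, Finset.mem_union_left _ hs, e⟩
  zero_mem' := ⟨fun h g => by simp, ∅, fun g hg => absurd rfl hg⟩
  smul_mem' := by
    rintro c f ⟨e, S, hS⟩
    refine ⟨fun h g => by simp [e], S, fun g hg => hS g fun h0 => hg ?_⟩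
    simp [h0]

/-- The underlying space of `ind_H^Γ σ`. -/
abbrev CInd : Type _ := cIndSub H σ

/-- The representation `ind_H^Γ σ`: the group `Γ` acts by right translation. -/
def cInd : Representation k Γ (CInd H σ) where
  toFun a := (LinearMap.funLeft k V (· * a)).restrict (by
    classical
    rintro f ⟨e, S, hS⟩
    refine ⟨fun h g => by simp [LinearMap.funLeft_apply, mul_assoc, e], S.image (· * a⁻¹), fun g hg => ?_⟩
    obtain ⟨h, hh, s, hs, e⟩ := hS (g * a) hg
    exact ⟨h, hh, s * a⁻¹, Finset.mem_image_of_mem _ hs, by rw [← mul_assoc, ← e]; group⟩)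
  map_one' := by
    refine LinearMap.ext fun f => Subtype.ext (funext fun g => ?_)
    change f.1 (g * 1) = f.1 g
    rw [mul_one]
  map_mul' a b := by
    refine LinearMap.ext fun f => Subtype.ext (funext fun g => ?_)
    change f.1 (g * (a * b)) = f.1 (g * a * b)
    rw [mul_assoc]

variable {H σ}

@[ext]
lemma CInd.ext {f f' : CInd H σ} (h : ∀ g, f.1 g = f'.1 g) : f = f' :=
  Subtype.ext (funext h)

lemma CInd.equivariant (f : CInd H σ) (h : H) (g : Γ) : f.1 (h * g) = σ h (f.1 g) :=
  f.2.1 h g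

@[simp] lemma cInd_apply (a : Γ) (f : CInd H σ) (g : Γ) :
    (cInd H σ a f).1 g = f.1 (g * a) := rfl

variable (H σ) in
open Classical in
/-- The function `[g, v]`, supported on `H g⁻¹`, with `[g, v](h g⁻¹) = σ(h) v`. -/
def bracket (g : Γ) : V →ₗ[k] CInd H σ where
  toFun v := ⟨fun x => if hx : x * g ∈ H then σ ⟨x * g, hx⟩ v else 0, by
      intro h x
      change (fun x => if hx : x * g ∈ H then σ ⟨x * g, hx⟩ v else 0) (H.subtype h * x) = _
      by_cases hx : x * g ∈ H
      · have hx' : H.subtype h * x * g ∈ H := by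
          rw [mul_assoc]; exact H.mul_mem h.2 hx
        have e : (⟨H.subtype h * x * g, hx'⟩ : H) = h * ⟨x * g, hx⟩ :=
          Subtype.ext (mul_assoc _ _ _)
        beta_reduce
        rw [dif_pos hx, dif_pos hx', e, map_mul]
        rfl
      · have hx' : H.subtype h * x * g ∉ H := by
          intro hc
          apply hx
          rw [mul_assoc] at hc
          exact (H.mul_mem_cancel_left h.2).1 hc
        beta_reduce
        rw [dif_neg hx, dif_neg hx', map_zero],
    {g⁻¹}, fun x hx => by
      by_cases hxg : x * g ∈ H
      · exact ⟨x * g, hxg, g⁻¹, Finset.mem_singleton_self _, by group⟩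
      · exact absurd (dif_neg hxg) hx⟩
  map_add' v v' := by
    ext x
    by_cases hx : x * g ∈ H <;> simp [hx]
  map_smul' c v := by
    ext x
    by_cases hx : x * g ∈ H <;> simp [hx]

open Classical in
lemma bracket_apply (g : Γ) (v : V) (x : Γ) :
    (bracket H σ g v).1 x = if hx : x * g ∈ H then σ ⟨x * g, hx⟩ v else 0 := rfl

lemma cInd_bracket (a g : Γ) (v : V) :
    cInd H σ a (bracket H σ g v) = bracket H σ (a * g) v := by
  classical
  ext x
  simp only [cInd_apply, bracket_apply, mul_assoc]

lemma bracket_mul (g : Γ) (h : H) (v : V) :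
    bracket H σ (g * h) v = bracket H σ g (σ h v) := by
  classical
  ext x
  simp only [bracket_apply]
  by_cases hx : x * g ∈ H
  · have hx' : x * (g * h) ∈ H := by rw [← mul_assoc]; exact H.mul_mem hx h.2
    have e : (⟨x * (g * h), hx'⟩ : H) = ⟨x * g, hx⟩ * h := Subtype.ext (mul_assoc _ _ _).symm
    rw [dif_pos hx, dif_pos hx', e, map_mul]
    rfl
  · have hx' : x * (g * h) ∉ H := by
      rw [← mul_assoc]
      exact fun hc => hx ((H.mul_mem_cancel_right h.2).1 hc)
    rw [dif_neg hx, dif_neg hx']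

/-! ### Frobenius reciprocity -/

lemma lift_aux {E : Type*} [AddCommMonoid E] [Module k E]
    {π : Representation k Γ E} {φ : V →ₗ[k] E}
    (hφ : ∀ (h : H) (v : V), φ (σ h v) = π h (φ v)) (f : CInd H σ) (x y : Γ)
    (hxy : QuotientGroup.leftRel H x y) :
    π x (φ (f.1 x⁻¹)) = π y (φ (f.1 y⁻¹)) := by
  rw [QuotientGroup.leftRel_apply] at hxy
  have e : y⁻¹ = ((⟨x⁻¹ * y, hxy⟩ : H)⁻¹ : H) * x⁻¹ := by simp
  rw [e, CInd.equivariant, hφ, ← Module.End.mul_apply, ← map_mul]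
  congr 2
  simp

/-- The summand at the coset `x H` in the Frobenius reciprocity formula. -/
def liftTerm {E : Type*} [AddCommMonoid E] [Module k E]
    {π : Representation k Γ E} {φ : V →ₗ[k] E}
    (hφ : ∀ (h : H) (v : V), φ (σ h v) = π h (φ v)) (f : CInd H σ) : Γ ⧸ H → E :=
  Quotient.lift (fun x => π x (φ (f.1 x⁻¹))) (lift_aux hφ f)

lemma liftTerm_mk {E : Type*} [AddCommMonoid E] [Module k E]
    {π : Representation k Γ E} {φ : V →ₗ[k] E}
    (hφ : ∀ (h : H) (v : V), φ (σ h v) = π h (φ v)) (f : CInd H σ) (x : Γ) :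
    liftTerm hφ f (x : Γ ⧸ H) = π x (φ (f.1 x⁻¹)) := rfl

lemma liftTerm_finite {E : Type*} [AddCommMonoid E] [Module k E]
    {π : Representation k Γ E} {φ : V →ₗ[k] E}
    (hφ : ∀ (h : H) (v : V), φ (σ h v) = π h (φ v)) (f : CInd H σ) :
    (Function.support (liftTerm hφ f)).Finite := by
  classical
  obtain ⟨-, S, hS⟩ := f.2
  refine (S.image (fun s => ((s⁻¹ : Γ) : Γ ⧸ H))).finite_toSet.subset ?_
  intro q hq
  induction q using QuotientGroup.induction_on with
  | H x =>
    rw [Function.mem_support, liftTerm_mk] at hq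
    have h0 : f.1 x⁻¹ ≠ 0 := by
      intro h0
      apply hq
      rw [h0, map_zero, map_zero]
    obtain ⟨h, hh, s, hs, e⟩ := hS _ h0
    refine Finset.mem_coe.2 (Finset.mem_image.2 ⟨s, hs, ?_⟩)
    rw [QuotientGroup.eq]
    have : x = s⁻¹ * h⁻¹ := by rw [← mul_inv_rev, ← e, inv_inv]
    rw [this]
    simpa using hh

/-- Frobenius reciprocity: an `H`-equivariant map `φ : σ → π` extends to the `Γ`-equivariant map
`ind_H^Γ σ → π` sending `[g, v]` to `π(g) φ(v)`. -/
def frob {E : Type*} [AddCommMonoid E] [Module k E]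
    (π : Representation k Γ E) (φ : V →ₗ[k] E)
    (hφ : ∀ (h : H) (v : V), φ (σ h v) = π h (φ v)) : (cInd H σ).IntertwiningMap π where
  toFun f := ∑ᶠ q, liftTerm hφ f q
  map_add' f f' := by
    rw [← finsum_add_distrib (liftTerm_finite hφ f) (liftTerm_finite hφ f')]
    refine finsum_congr fun q => ?_
    induction q using QuotientGroup.induction_on with
    | H x => simp [liftTerm_mk]
  map_smul' c f := by
    rw [RingHom.id_apply, smul_finsum' c (liftTerm_finite hφ f)]
    refine finsum_congr fun q => ?_
    induction q using QuotientGroup.induction_on with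
    | H x => simp [liftTerm_mk]
  isIntertwining' a := by
    ext f
    change (∑ᶠ q, liftTerm hφ (cInd H σ a f) q) = π a (∑ᶠ q, liftTerm hφ f q)
    rw [show π a (∑ᶠ q, liftTerm hφ f q) = ∑ᶠ q, π a (liftTerm hφ f q) from
      (π a).toAddMonoidHom.map_finsum (liftTerm_finite hφ f)]
    refine finsum_eq_of_bijective (fun q => a⁻¹ • q) (MulAction.bijective a⁻¹) fun q => ?_
    induction q using QuotientGroup.induction_on with
    | H x =>
      rw [MulAction.Quotient.smul_coe, liftTerm_mk, liftTerm_mk, ← Module.End.mul_apply,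
        ← map_mul]
      simp

lemma frob_bracket {E : Type*} [AddCommMonoid E] [Module k E]
    (π : Representation k Γ E) (φ : V →ₗ[k] E)
    (hφ : ∀ (h : H) (v : V), φ (σ h v) = π h (φ v)) (g : Γ) (v : V) :
    frob π φ hφ (bracket H σ g v) = π g (φ v) := by
  classical
  change (∑ᶠ q, liftTerm hφ (bracket H σ g v) q) = _
  rw [finsum_eq_single _ (g : Γ ⧸ H), liftTerm_mk, bracket_apply, dif_pos (by simp)]
  · have e : (⟨g⁻¹ * g, by simp⟩ : H) = 1 := Subtype.ext (by simp)
    rw [e, map_one]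
    rfl
  · intro q hq
    induction q using QuotientGroup.induction_on with
    | H x =>
      rw [liftTerm_mk, bracket_apply, dif_neg, map_zero, map_zero]
      intro hx
      exact hq (QuotientGroup.eq.2 hx)

end General

section Groups

variable (p : ℕ) [Fact p.Prime]

/-- `G = GL₂(ℚ_p)`. -/
abbrev G : Type := Matrix.GeneralLinearGroup (Fin 2) ℚ_[p]

/-- `K = GL₂(ℤ_p)`. -/
abbrev K : Type := Matrix.GeneralLinearGroup (Fin 2) ℤ_[p]

/-- The inclusion of `K` in `G`. -/
def KtoG : K p →* G p := Matrix.GeneralLinearGroup.map PadicInt.Coe.ringHom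

/-- The Iwahori subgroup `I` of `K`: matrices that are upper triangular mod `p`. -/
def I : Subgroup (K p) where
  carrier := {h | PadicInt.toZMod (h.1 1 0) = 0}
  one_mem' := by simp
  mul_mem' := by
    intro a b ha hb
    simp only [Set.mem_ofPred_eq] at ha hb ⊢
    simp [Matrix.mul_apply, Fin.sum_univ_two, ha, hb]
  inv_mem' := by
    intro a ha
    simp only [Set.mem_ofPred_eq] at ha ⊢
    rw [Matrix.coe_units_inv, Matrix.inv_def, Matrix.adjugate_fin_two]
    simp [ha]

lemma KtoG_apply (κ : K p) (i j : Fin 2) : (KtoG p κ).1 i j = (κ.1 i j : ℚ_[p]) := rfl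

lemma p_ne_zero : (p : ℚ_[p]) ≠ 0 := by
  exact_mod_cast (Fact.out : p.Prime).ne_zero

/-- `p` as an element of `ℚ_pˣ`. -/
def pUnit : ℚ_[p]ˣ := Units.mk0 (p : ℚ_[p]) (p_ne_zero p)

lemma norm_unitPart (x : ℚ_[p]ˣ) :
    ‖(x : ℚ_[p]) * (p : ℚ_[p]) ^ (-(x : ℚ_[p]).valuation)‖ = 1 := by
  have hp : (p : ℝ) ≠ 0 := by exact_mod_cast (Fact.out : p.Prime).ne_zero
  rw [norm_mul, Padic.norm_eq_zpow_neg_valuation x.ne_zero, Padic.norm_p_zpow, neg_neg,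
    ← zpow_add₀ hp]
  simp

/-- The unit part `x p^(-v(x)) ∈ ℤ_pˣ` of `x ∈ ℚ_pˣ`. -/
def unitPart : ℚ_[p]ˣ →* ℤ_[p]ˣ where
  toFun x := PadicInt.mkUnits (norm_unitPart p x)
  map_one' := by
    refine Units.ext (Subtype.ext ?_)
    simp [PadicInt.mkUnits]
  map_mul' x y := by
    refine Units.ext (Subtype.ext ?_)
    have hp := p_ne_zero p
    change ((x * y : ℚ_[p]ˣ) : ℚ_[p]) * (p : ℚ_[p]) ^ (-((x * y : ℚ_[p]ˣ) : ℚ_[p]).valuation) =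
      ((x : ℚ_[p]) * (p : ℚ_[p]) ^ (-(x : ℚ_[p]).valuation)) *
        ((y : ℚ_[p]) * (p : ℚ_[p]) ^ (-(y : ℚ_[p]).valuation))
    rw [Units.val_mul, Padic.valuation_mul x.ne_zero y.ne_zero, neg_add, zpow_add₀ hp]
    ring

/-- The scalar matrix `p`, an element of the centre `Z` of `G`. -/
def pScalar : G p := Matrix.GeneralLinearGroup.scalar (Fin 2) (pUnit p)

lemma pScalar_zpow_comm (n : ℤ) (g : G p) : pScalar p ^ n * g = g * pScalar p ^ n :=
  ((show Commute (pScalar p) g from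
    Matrix.GeneralLinearGroup.scalar_commute (pUnit p) g).zpow_left n).eq

/-- The map `(κ, n) ↦ pⁿ κ` from `K × p^ℤ` to `G`. -/
def KpToG : K p × Multiplicative ℤ →* G p where
  toFun x := pScalar p ^ x.2.toAdd * KtoG p x.1
  map_one' := by simp
  map_mul' x y := by
    rw [Prod.fst_mul, Prod.snd_mul, toAdd_mul, zpow_add, map_mul]
    rw [mul_assoc, mul_assoc, ← mul_assoc (KtoG p x.1), ← pScalar_zpow_comm, mul_assoc]

lemma KpToG_injective : Function.Injective (KpToG p) := by
  rw [injective_iff_map_eq_one]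
  rintro ⟨κ, n⟩ h
  have hn : n.toAdd = 0 := by
    have hd := congrArg (fun g : G p => ‖(Matrix.GeneralLinearGroup.det g : ℚ_[p])‖) h
    have h1 : ‖(Matrix.GeneralLinearGroup.det (KtoG p κ) : ℚ_[p])‖ = 1 := by
      have e : (Matrix.GeneralLinearGroup.det (KtoG p κ) : ℚ_[p]) =
          ((Matrix.GeneralLinearGroup.det κ : ℤ_[p]ˣ) : ℤ_[p]) := by
        simp [Matrix.det_fin_two, KtoG_apply]
      rw [e]
      exact PadicInt.norm_units _
    have h2 : ((Matrix.GeneralLinearGroup.det (pScalar p) : ℚ_[p]ˣ) : ℚ_[p]) = (p : ℚ_[p]) ^ 2 := by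
      simp [pScalar, pUnit]
    simp only [KpToG, MonoidHom.coe_mk, OneHom.coe_mk, map_mul, map_zpow, Units.val_mul,
      Units.val_zpow_eq_zpow_val, norm_mul, h1, h2, norm_zpow, norm_pow, Padic.norm_p, map_one,
      Units.val_one, norm_one, mul_one] at hd
    have hp : (1 : ℝ) < p := by exact_mod_cast (Fact.out : p.Prime).one_lt
    rw [inv_pow, inv_zpow, inv_eq_one, ← zpow_natCast, ← zpow_mul] at hd
    have := (zpow_eq_one_iff_right₀ (by linarith) hp.ne').1 hd
    simpa using this
  have hn' : n = 1 := by simpa using hn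
  subst hn'
  have hκ : KtoG p κ = 1 := by simpa [KpToG] using h
  have : κ = 1 := by
    refine Units.ext (Matrix.ext fun i j => ?_)
    have hij := congrArg (fun g : G p => g.1 i j) hκ
    have : ((κ.1 i j : ℤ_[p]) : ℚ_[p]) = ((1 : Matrix (Fin 2) (Fin 2) ℤ_[p]) i j : ℤ_[p]) := by
      refine Eq.trans (KtoG_apply p κ i j).symm (hij.trans ?_)
      by_cases e : i = j <;> simp [e, Matrix.one_apply]
    exact Subtype.ext this
  rw [this]
  rfl

/-- The subgroup `KZ` of `G`, written as `K p^ℤ` (recall that `Z = ℤ_pˣ p^ℤ`). -/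
def KZ : Subgroup (G p) := (KpToG p).range

/-- The decomposition `KZ ≅ K × p^ℤ`. -/
def KZEquiv : K p × Multiplicative ℤ ≃* KZ p := MonoidHom.ofInjective (KpToG_injective p)

/-- The map `(h, n) ↦ pⁿ h` from `I × p^ℤ` to `G`. -/
def IpToG : I p × Multiplicative ℤ →* G p :=
  (KpToG p).comp ((I p).subtype.prodMap (MonoidHom.id _))

lemma IpToG_injective : Function.Injective (IpToG p) :=
  (KpToG_injective p).comp (Prod.map_injective.2 ⟨Subtype.val_injective, Function.injective_id⟩)

/-- The subgroup `IZ` of `G`, written as `I p^ℤ`. -/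
def IZ : Subgroup (G p) := (IpToG p).range

/-- The decomposition `IZ ≅ I × p^ℤ`. -/
def IZEquiv : I p × Multiplicative ℤ ≃* IZ p := MonoidHom.ofInjective (IpToG_injective p)

lemma pScalar_mem_center : pScalar p ∈ Subgroup.center (G p) :=
  Subgroup.mem_center_iff.2 fun g =>
    (Matrix.GeneralLinearGroup.scalar_commute (pUnit p) g).symm

lemma center_decomp (z : G p) (hz : z ∈ Subgroup.center (G p)) : ∃ (u : ℤ_[p]ˣ) (n : ℤ),
    z = pScalar p ^ n * KtoG p (Matrix.GeneralLinearGroup.scalar (Fin 2) u) := by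
  rw [Matrix.GeneralLinearGroup.center_eq_range_scalar] at hz
  obtain ⟨x, rfl⟩ := hz
  let n := (x : ℚ_[p]).valuation
  have hx : ‖(x : ℚ_[p]) * (p : ℚ_[p]) ^ (-n)‖ = 1 := norm_unitPart p x
  refine ⟨PadicInt.mkUnits hx, n, ?_⟩
  have hu : x = pUnit p ^ n * Units.map PadicInt.Coe.ringHom.toMonoidHom (PadicInt.mkUnits hx) := by
    refine Units.ext ?_
    have hp := p_ne_zero p
    change (x : ℚ_[p]) = _ * ((PadicInt.mkUnits hx : ℤ_[p]ˣ) : ℤ_[p])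
    rw [PadicInt.mkUnits_eq, Units.val_zpow_eq_zpow_val]
    change (x : ℚ_[p]) = (p : ℚ_[p]) ^ n * ((x : ℚ_[p]) * (p : ℚ_[p]) ^ (-n))
    rw [zpow_neg]
    field_simp
  conv_lhs => rw [hu, map_mul, map_zpow]
  congr 1
  refine Units.ext (Matrix.ext fun i j => ?_)
  rw [KtoG_apply]
  simp only [Matrix.GeneralLinearGroup.scalar, Units.coe_map, MonoidHom.coe_coe,
    Matrix.scalar_apply, RingHom.toMonoidHom_eq_coe]
  by_cases e : i = j
  · subst e
    simp only [Matrix.diagonal_apply_eq]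
    rfl
  · simp only [Matrix.diagonal_apply_ne _ e]
    rfl

/-- The two descriptions of `KZ` and `IZ` agree with the usual ones. -/
lemma KZ_eq : KZ p = (KtoG p).range ⊔ Subgroup.center (G p) := by
  apply le_antisymm
  · rintro _ ⟨⟨κ, n⟩, rfl⟩
    refine Subgroup.mul_mem _ ?_ ?_
    · exact Subgroup.mem_sup_right (Subgroup.zpow_mem _ (pScalar_mem_center p) _)
    · exact Subgroup.mem_sup_left ⟨κ, rfl⟩
  · refine sup_le ?_ fun z hz => ?_
    · rintro _ ⟨κ, rfl⟩
      exact ⟨(κ, 1), by simp [KpToG]⟩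
    · obtain ⟨u, n, rfl⟩ := center_decomp p z hz
      exact ⟨(Matrix.GeneralLinearGroup.scalar (Fin 2) u, Multiplicative.ofAdd n), rfl⟩

lemma IZ_eq : IZ p = ((I p).map (KtoG p)) ⊔ Subgroup.center (G p) := by
  apply le_antisymm
  · rintro _ ⟨⟨κ, n⟩, rfl⟩
    refine Subgroup.mul_mem _ ?_ ?_
    · exact Subgroup.mem_sup_right (Subgroup.zpow_mem _ (pScalar_mem_center p) _)
    · exact Subgroup.mem_sup_left ⟨κ.1, κ.2, rfl⟩
  · refine sup_le ?_ fun z hz => ?_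
    · rintro _ ⟨κ, hκ, rfl⟩
      exact ⟨(⟨κ, hκ⟩, 1), by simp [IpToG, KpToG]⟩
    · obtain ⟨u, n, rfl⟩ := center_decomp p z hz
      refine ⟨(⟨Matrix.GeneralLinearGroup.scalar (Fin 2) u, ?_⟩, Multiplicative.ofAdd n), rfl⟩
      change PadicInt.toZMod _ = 0
      simp

variable (k : Type*) [Field k] [Algebra (ZMod p) k]

/-- Reduction `ℤ_p → 𝔽_p → k`. -/
def redk : ℤ_[p] →+* k := (algebraMap (ZMod p) k).comp PadicInt.toZMod

/-- The character `d^r` of `IZ`: it sends `pⁿ h`, with `h = (a b; c d) ∈ I`, to `d^r mod p`. -/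
def dChar (r : ℕ) : Representation k (IZ p) k where
  toFun x := (redk p k (((IZEquiv p).symm x).1.1.1 1 1)) ^ r • LinearMap.id
  map_one' := by
    ext
    simp
  map_mul' x y := by
    have h := ((IZEquiv p).symm x).1.2
    ext
    have h0 : PadicInt.toZMod (((IZEquiv p).symm x).1.1.1 1 0) = 0 := h
    simp [Matrix.mul_apply, Fin.sum_univ_two, redk, h0, mul_pow]
    ring

variable {k}

/-- The substitution `P(X, Y) ↦ P(aX + cY, bX + dY)` attached to `M = (a b; c d)`, where
`X = X 0` and `Y = X 1`. -/
def subst (M : Matrix (Fin 2) (Fin 2) k) :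
    MvPolynomial (Fin 2) k →ₐ[k] MvPolynomial (Fin 2) k :=
  MvPolynomial.aeval fun j => ∑ i, MvPolynomial.C (M i j) * MvPolynomial.X i

lemma subst_one : subst (1 : Matrix (Fin 2) (Fin 2) k) = AlgHom.id k _ := by
  refine MvPolynomial.algHom_ext fun j => ?_
  fin_cases j <;> simp [subst]

lemma subst_mul (M N : Matrix (Fin 2) (Fin 2) k) : subst (M * N) = (subst M).comp (subst N) := by
  refine MvPolynomial.algHom_ext fun j => ?_
  simp only [subst, MvPolynomial.aeval_X, AlgHom.comp_apply, Matrix.mul_apply, Fin.sum_univ_two,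
    map_add, map_mul, MvPolynomial.algHom_C, MvPolynomial.algebraMap_eq]
  ring

lemma subst_mem (M : Matrix (Fin 2) (Fin 2) k) (r : ℕ) (P : MvPolynomial (Fin 2) k)
    (hP : P ∈ MvPolynomial.homogeneousSubmodule (Fin 2) k r) :
    subst M P ∈ MvPolynomial.homogeneousSubmodule (Fin 2) k r := by
  rw [MvPolynomial.mem_homogeneousSubmodule] at hP ⊢
  have h1 := hP.aeval (fun j : Fin 2 =>
    ∑ i, MvPolynomial.C (M i j) * (MvPolynomial.X i : MvPolynomial (Fin 2) k)) (n := 1)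
    (fun j => MvPolynomial.IsHomogeneous.sum _ _ _ fun i _ => by
      simpa using (MvPolynomial.isHomogeneous_C (Fin 2) (M i j)).mul
        (MvPolynomial.isHomogeneous_X k i))
  rwa [one_mul] at h1

/-- The space of `V_r`: homogeneous polynomials of degree `r` in `X, Y`. -/
def Sym (k : Type*) [Field k] (r : ℕ) : Type _ := MvPolynomial.homogeneousSubmodule (Fin 2) k r

instance (k : Type*) [Field k] (r : ℕ) : AddCommGroup (Sym k r) :=
  inferInstanceAs (AddCommGroup (MvPolynomial.homogeneousSubmodule (Fin 2) k r))

instance (k : Type*) [Field k] (r : ℕ) : Module k (Sym k r) :=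
  inferInstanceAs (Module k (MvPolynomial.homogeneousSubmodule (Fin 2) k r))

/-- The action of `2 × 2` matrices on homogeneous polynomials of degree `r` in `X, Y`:
`(a b; c d)` sends `P(X, Y)` to `P(aX + cY, bX + dY)`. -/
def symAct (r : ℕ) : Matrix (Fin 2) (Fin 2) k →* Module.End k (Sym k r) where
  toFun M := (subst M).toLinearMap.restrict (subst_mem M r)
  map_one' := by
    refine LinearMap.ext fun P => Subtype.ext ?_
    change subst 1 P.1 = P.1
    rw [subst_one]
    rfl
  map_mul' M N := by
    refine LinearMap.ext fun P => Subtype.ext ?_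
    change subst (M * N) P.1 = subst M (subst N P.1)
    rw [subst_mul]
    rfl

variable (k)

/-- The `r`-th symmetric power `V_r` of the standard representation, as a representation of `KZ`
with `K` acting through reduction mod `p` and the scalar matrix `p` acting trivially. -/
def symRep (r : ℕ) : Representation k (KZ p) (Sym k r) :=
  (symAct r).comp ((redk p k).mapMatrix.toMonoidHom.comp
    ((Units.coeHom _).comp ((MonoidHom.fst _ _).comp (KZEquiv p).symm.toMonoidHom)))

/-- The Teichmüller representative `[x] ∈ ℤ_p` of `x ∈ 𝔽_p`. -/
def teich (x : ZMod p) : ℤ_[p] := WittVector.equiv p (WittVector.teichmuller p x)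

lemma toZMod_teich (x : ZMod p) : PadicInt.toZMod (teich p x) = x := by
  have key : ∀ f : ℤ_[p] →+* ZMod p, f = PadicInt.toZMod := by
    intro f
    ext z
    have hz := PadicInt.toZMod_spec z
    rw [PadicInt.maximalIdeal_eq_span_p, Ideal.mem_span_singleton] at hz
    obtain ⟨w, hw⟩ := hz
    have h2 := congrArg f hw
    have h3 : f (ZMod.cast (PadicInt.toZMod z)) = PadicInt.toZMod z := by
      rw [← ZMod.natCast_val, map_natCast, ZMod.natCast_val, ZMod.cast_id]
    rw [map_sub, map_mul, map_natCast, CharP.cast_eq_zero, zero_mul, h3, sub_eq_zero] at h2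
    exact h2
  have h := key ((WittVector.constantCoeff).comp (WittVector.equiv p).symm.toRingHom)
  rw [← h]
  simp [teich]

end Groups

section Hecke

variable (p : ℕ) [Fact p.Prime]

lemma det_map_ne_zero (A : Matrix (Fin 2) (Fin 2) ℤ_[p]) (h : A.det ≠ 0) :
    (A.map PadicInt.Coe.ringHom).det ≠ 0 := by
  have e : (A.map PadicInt.Coe.ringHom).det = PadicInt.Coe.ringHom A.det :=
    (RingHom.map_det _ A).symm
  rw [e]
  intro h0
  exact h (Subtype.ext h0)

/-- The element of `G` given by a matrix over `ℤ_p` of non-zero determinant. -/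
def toG (A : Matrix (Fin 2) (Fin 2) ℤ_[p]) (h : A.det ≠ 0) : G p :=
  Matrix.GeneralLinearGroup.mkOfDetNeZero (A.map PadicInt.Coe.ringHom) (det_map_ne_zero p A h)

lemma KtoG_mul_toG {A B : Matrix (Fin 2) (Fin 2) ℤ_[p]} (hA : A.det ≠ 0) (hB : B.det ≠ 0)
    {κ κ' : K p} (h : κ.1 * A = B * κ'.1) : KtoG p κ * toG p A hA = toG p B hB * KtoG p κ' := by
  refine Units.ext ?_
  have := congrArg (fun M : Matrix (Fin 2) (Fin 2) ℤ_[p] => PadicInt.Coe.ringHom.mapMatrix M) h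
  simp only [map_mul] at this
  exact this

lemma pInt_ne_zero : (p : ℤ_[p]) ≠ 0 := by
  exact_mod_cast (Fact.out : p.Prime).ne_zero

lemma exists_eq_p_mul {x : ℤ_[p]} (h : PadicInt.toZMod x = 0) : ∃ y, x = p * y := by
  have : x ∈ RingHom.ker (PadicInt.toZMod : ℤ_[p] →+* ZMod p) := h
  rw [PadicInt.ker_toZMod, PadicInt.maximalIdeal_eq_span_p, Ideal.mem_span_singleton] at this
  exact this

lemma exists_conj {A B : Matrix (Fin 2) (Fin 2) ℤ_[p]} (hA : A.det = p) (hB : B.det = p) (κ : K p)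
    (h : ∀ i j, PadicInt.toZMod ((B.adjugate * κ.1 * A) i j) = 0) :
    ∃ κ' : K p, κ.1 * A = B * κ'.1 ∧ κ'.1 * A.adjugate = B.adjugate * κ.1 := by
  choose M hM using fun i j => exists_eq_p_mul p (h i j)
  have hM' : B.adjugate * κ.1 * A = (p : ℤ_[p]) • (Matrix.of M) := by
    ext i j
    rw [hM i j]
    simp
  have hp := pInt_ne_zero p
  have h1 : κ.1 * A = B * Matrix.of M := by
    have e : (p : ℤ_[p]) • (κ.1 * A) = (p : ℤ_[p]) • (B * Matrix.of M) := by
      rw [← Matrix.mul_smul B, ← hM', ← mul_assoc, ← mul_assoc, Matrix.mul_adjugate, hB]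
      simp
    exact smul_right_injective _ hp e
  have hdet : (Matrix.of M).det = κ.1.det := by
    have := congrArg Matrix.det h1
    rw [Matrix.det_mul, Matrix.det_mul, hA, hB, mul_comm] at this
    exact (mul_left_cancel₀ hp this).symm
  have hu : IsUnit (Matrix.of M) := by
    rw [Matrix.isUnit_iff_isUnit_det, hdet]
    exact (Matrix.isUnit_iff_isUnit_det _).1 κ.isUnit
  refine ⟨hu.unit, h1, ?_⟩
  have e : (p : ℤ_[p]) • (Matrix.of M * A.adjugate) = (p : ℤ_[p]) • (B.adjugate * κ.1) := by
    rw [← Matrix.smul_mul, ← hM', mul_assoc, Matrix.mul_adjugate, hA]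
    simp
  exact smul_right_injective _ hp e

/-- The matrix `(p [x]; 0 1)`. -/
def upMat (x : ZMod p) : Matrix (Fin 2) (Fin 2) ℤ_[p] := !![(p : ℤ_[p]), teich p x; 0, 1]

/-- The matrix `(1 0; p[x] p)`. -/
def lowMat (x : ZMod p) : Matrix (Fin 2) (Fin 2) ℤ_[p] := !![1, 0; p * teich p x, (p : ℤ_[p])]

/-- The matrix `α = (1 0; 0 p)`. -/
def alphaMat : Matrix (Fin 2) (Fin 2) ℤ_[p] := !![1, 0; 0, (p : ℤ_[p])]

/-- The matrix `β = (0 1; p 0)`. -/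
def betaMat : Matrix (Fin 2) (Fin 2) ℤ_[p] := !![0, 1; (p : ℤ_[p]), 0]

lemma det_upMat (x : ZMod p) : (upMat p x).det = p := by simp [upMat, Matrix.det_fin_two]
lemma det_lowMat (x : ZMod p) : (lowMat p x).det = p := by simp [lowMat, Matrix.det_fin_two]
lemma det_alphaMat : (alphaMat p).det = p := by simp [alphaMat, Matrix.det_fin_two]
lemma det_betaMat : (betaMat p).det = -p := by simp [betaMat, Matrix.det_fin_two]

/-- `(p [x]; 0 1)` in `G`. -/
def up (x : ZMod p) : G p := toG p (upMat p x) (by rw [det_upMat]; exact pInt_ne_zero p)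

/-- `(1 0; p[x] p)` in `G`. -/
def low (x : ZMod p) : G p := toG p (lowMat p x) (by rw [det_lowMat]; exact pInt_ne_zero p)

/-- `α` in `G`. -/
def alpha : G p := toG p (alphaMat p) (by rw [det_alphaMat]; exact pInt_ne_zero p)

/-- `β` in `G`. -/
def beta : G p := toG p (betaMat p) (by rw [det_betaMat]; exact neg_ne_zero.2 (pInt_ne_zero p))

/-! #### The spherical Hecke operator -/

/-- The elements `(p [x]; 0 1)`, `x ∈ 𝔽_p`, and `α`, indexed by `ℙ¹(𝔽_p)`. -/
def sphMat (x : OnePoint (ZMod p)) : Matrix (Fin 2) (Fin 2) ℤ_[p] :=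
  x.elim (alphaMat p) (upMat p)

lemma det_sphMat (x : OnePoint (ZMod p)) : (sphMat p x).det = p := by
  induction x using OnePoint.rec with
  | infty => exact det_alphaMat p
  | coe x => exact det_upMat p x

lemma sphMat_conj (κ : K p) (x : OnePoint (ZMod p)) (i j : Fin 2) :
    PadicInt.toZMod (((sphMat p (Matrix.GeneralLinearGroup.map PadicInt.toZMod κ • x)).adjugate *
      κ.1 * sphMat p x) i j) = 0 := by
  set κb := Matrix.GeneralLinearGroup.map (n := Fin 2) PadicInt.toZMod κ with hκ
  have e : ∀ i j, PadicInt.toZMod (κ.1 i j) = κb i j := fun i j => rfl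
  have eκ : κ.1 = !![κ.1 0 0, κ.1 0 1; κ.1 1 0, κ.1 1 1] := Matrix.eta_fin_two _
  induction x using OnePoint.rec with
  | infty =>
    rw [OnePoint.smul_infty_eq_ite]
    split_ifs with h
    · have h' : PadicInt.toZMod (κ.1 1 0) = 0 := h
      rw [eκ]
      fin_cases i <;> fin_cases j <;>
      simp [sphMat, alphaMat, Matrix.adjugate_fin_two, h']
    · have h' : PadicInt.toZMod (κ.1 1 0) ≠ 0 := h
      rw [← e, ← e, eκ]
      fin_cases i <;> fin_cases j <;>
      simp [sphMat, alphaMat, upMat, Matrix.adjugate_fin_two, toZMod_teich, h']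
  | coe x =>
    rw [OnePoint.smul_some_eq_ite]
    split_ifs with h
    · rw [← e, ← e] at h
      rw [eκ]
      fin_cases i <;> fin_cases j <;>
      simp [sphMat, alphaMat, upMat, Matrix.adjugate_fin_two, toZMod_teich, h]
    · rw [← e, ← e] at h
      rw [← e, ← e, ← e, ← e, eκ]
      fin_cases i <;> fin_cases j <;>
      simp [sphMat, upMat, Matrix.adjugate_fin_two, toZMod_teich]
      linear_combination -(div_mul_cancel₀ (PadicInt.toZMod (κ.1 0 0) * x +
        PadicInt.toZMod (κ.1 0 1)) h)

/-- The elements `(p [x]; 0 1)`, `x ∈ 𝔽_p`, and `α` of `G`, indexed by `ℙ¹(𝔽_p)`. -/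
def sph (x : OnePoint (ZMod p)) : G p :=
  toG p (sphMat p x) (by rw [det_sphMat]; exact pInt_ne_zero p)

lemma sph_coe (x : ZMod p) : sph p (x : OnePoint (ZMod p)) = up p x := rfl

lemma sph_infty : sph p OnePoint.infty = alpha p := rfl

lemma sum_onePoint {M : Type*} [AddCommMonoid M] (f : OnePoint (ZMod p) → M) :
    ∑ x, f x = f OnePoint.infty + ∑ x : ZMod p, f x := Fintype.sum_option f

variable (k : Type*) [Field k] [Algebra (ZMod p) k]

/-- The map `P ↦ ∑_x [(p [x]; 0 1), P(X, -xX + pY)] + [α, P(pX, Y)]`. -/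
def heckeVec (r : ℕ) : Sym k r →ₗ[k] CInd (KZ p) (symRep p k r) :=
  ∑ x : ZMod p, bracket (KZ p) (symRep p k r) (up p x) ∘ₗ
      symAct r !![1, -(algebraMap (ZMod p) k x); 0, (p : k)] +
    bracket (KZ p) (symRep p k r) (alpha p) ∘ₗ symAct r !![(p : k), 0; 0, 1]

lemma redk_adj_coe (x : ZMod p) : (redk p k).mapMatrix (sphMat p (x : OnePoint (ZMod p))).adjugate =
    !![1, -(algebraMap (ZMod p) k x); 0, (p : k)] := by
  have e : sphMat p (x : OnePoint (ZMod p)) = upMat p x := rfl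
  rw [e, upMat, Matrix.adjugate_fin_two_of]
  ext i j
  fin_cases i <;> fin_cases j <;>
  simp [redk, toZMod_teich, ← map_natCast (algebraMap (ZMod p) k)]

lemma redk_adj_infty : (redk p k).mapMatrix (sphMat p OnePoint.infty).adjugate =
    !![(p : k), 0; 0, 1] := by
  have e : sphMat p OnePoint.infty = alphaMat p := rfl
  rw [e, alphaMat, Matrix.adjugate_fin_two_of]
  ext i j
  fin_cases i <;> fin_cases j <;>
  simp [redk, ← map_natCast (algebraMap (ZMod p) k)]

lemma heckeVec_apply (r : ℕ) (P : Sym k r) : heckeVec p k r P = ∑ x : OnePoint (ZMod p),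
    bracket (KZ p) (symRep p k r) (sph p x)
      (symAct r ((redk p k).mapMatrix (sphMat p x).adjugate) P) := by
  rw [sum_onePoint, add_comm, redk_adj_infty, sph_infty]
  simp only [redk_adj_coe, sph_coe]
  rw [heckeVec, LinearMap.add_apply, LinearMap.sum_apply]
  rfl

lemma mem_KZ (x : K p × Multiplicative ℤ) : KpToG p x ∈ KZ p := ⟨x, rfl⟩

lemma KZEquiv_symm (x : K p × Multiplicative ℤ) : (KZEquiv p).symm ⟨KpToG p x, mem_KZ p x⟩ = x :=
  (KZEquiv p).symm_apply_eq.2 rfl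

lemma symRep_apply (r : ℕ) (x : K p × Multiplicative ℤ) :
    symRep p k r ⟨KpToG p x, mem_KZ p x⟩ = symAct r ((redk p k).mapMatrix x.1.1) := by
  have : symRep p k r ⟨KpToG p x, mem_KZ p x⟩ =
    symAct r ((redk p k).mapMatrix ((KZEquiv p).symm ⟨KpToG p x, mem_KZ p x⟩).1.1) := rfl
  rw [this, KZEquiv_symm]

lemma KpToG_mul_sph (κ κ' : K p) (n : Multiplicative ℤ) (x y : OnePoint (ZMod p))
    (h : κ.1 * sphMat p x = sphMat p y * κ'.1) :
    KpToG p (κ, n) * sph p x = sph p y * KpToG p (κ', n) := by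
  change pScalar p ^ n.toAdd * KtoG p κ * _ = _ * (pScalar p ^ n.toAdd * KtoG p κ')
  rw [mul_assoc, sph, KtoG_mul_toG p _ _ h, ← mul_assoc, pScalar_zpow_comm, mul_assoc]
  rfl

lemma symAct_symAct (r : ℕ) (A B : Matrix (Fin 2) (Fin 2) k) (P : Sym k r) :
    symAct r A (symAct r B P) = symAct r (A * B) P := by
  rw [map_mul]
  rfl

lemma heckeVec_equivariant (r : ℕ) (h : KZ p) (P : Sym k r) :
    heckeVec p k r (symRep p k r h P) = cInd (KZ p) (symRep p k r) h (heckeVec p k r P) := by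
  obtain ⟨_, ⟨⟨κ, n⟩, rfl⟩⟩ := h
  rw [heckeVec_apply, heckeVec_apply, map_sum, symRep_apply]
  symm
  refine Fintype.sum_equiv
    (MulAction.toPerm (Matrix.GeneralLinearGroup.map (n := Fin 2) PadicInt.toZMod κ)) _ _ fun x => ?_
  rw [MulAction.toPerm_apply]
  obtain ⟨κ', h1, h2⟩ := exists_conj p (det_sphMat p x) (det_sphMat p _) κ (sphMat_conj p κ x)
  rw [cInd_bracket, KpToG_mul_sph p κ κ' n _ _ h1,
    bracket_mul (h := ⟨KpToG p (κ', n), mem_KZ p _⟩), symRep_apply]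
  refine congrArg (bracket (KZ p) (symRep p k r) _) ?_
  rw [symAct_symAct, symAct_symAct, ← map_mul, ← map_mul, h2]

/-- The spherical Hecke operator `T` on `ind_{KZ}^G V_r`: the `G`-endomorphism with
`T[1, P] = ∑_x [(p [x]; 0 1), P(X, -xX + pY)] + [α, P(pX, Y)]`. -/
def T (r : ℕ) :
    (cInd (KZ p) (symRep p k r)).IntertwiningMap (cInd (KZ p) (symRep p k r)) :=
  frob (cInd (KZ p) (symRep p k r)) (heckeVec p k r) (heckeVec_equivariant p k r)

/-! #### The Iwahori–Hecke operators -/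

/-- The vector `∑_x [[(p [x]; 0 1), v]]`. -/
def upVec (r : ℕ) : k →ₗ[k] CInd (IZ p) (dChar p k r) :=
  ∑ x : ZMod p, bracket (IZ p) (dChar p k r) (up p x)

/-- The vector `∑_x [[(1 0; p[x] p), v]]`. -/
def lowVec (r : ℕ) : k →ₗ[k] CInd (IZ p) (dChar p k r) :=
  ∑ x : ZMod p, bracket (IZ p) (dChar p k r) (low p x)

lemma mem_IZ (x : I p × Multiplicative ℤ) : IpToG p x ∈ IZ p := ⟨x, rfl⟩

lemma IZEquiv_symm (x : I p × Multiplicative ℤ) : (IZEquiv p).symm ⟨IpToG p x, mem_IZ p x⟩ = x :=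
  (IZEquiv p).symm_apply_eq.2 rfl

lemma dChar_apply (r : ℕ) (x : I p × Multiplicative ℤ) (v : k) :
    dChar p k r ⟨IpToG p x, mem_IZ p x⟩ v = redk p k (x.1.1.1 1 1) ^ r * v := by
  have : dChar p k r ⟨IpToG p x, mem_IZ p x⟩ v =
    redk p k (((IZEquiv p).symm ⟨IpToG p x, mem_IZ p x⟩).1.1.1 1 1) ^ r * v := rfl
  rw [this, IZEquiv_symm]

lemma cInd_IZ_bracket (r : ℕ) {A B : Matrix (Fin 2) (Fin 2) ℤ_[p]} (hA : A.det ≠ 0)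
    (hB : B.det ≠ 0) (h h' : I p) (n : Multiplicative ℤ) (e : h.1.1 * A = B * h'.1.1)
    (v : k) : cInd (IZ p) (dChar p k r) (IpToG p (h, n)) (bracket _ _ (toG p A hA) v) =
      bracket _ _ (toG p B hB) (redk p k (h'.1.1 1 1) ^ r * v) := by
  have h4 : IpToG p (h, n) * toG p A hA = toG p B hB * IpToG p (h', n) := by
    change pScalar p ^ n.toAdd * KtoG p h.1 * _ = _ * (pScalar p ^ n.toAdd * KtoG p h'.1)
    rw [mul_assoc, KtoG_mul_toG p hA hB e, ← mul_assoc, pScalar_zpow_comm, mul_assoc]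
  rw [cInd_bracket, h4, bracket_mul (h := ⟨IpToG p (h', n), mem_IZ p _⟩), dChar_apply]

lemma I_diag (h : I p) : PadicInt.toZMod (h.1.1 0 0) ≠ 0 ∧ PadicInt.toZMod (h.1.1 1 1) ≠ 0 := by
  have h0 : PadicInt.toZMod (h.1.1 1 0) = 0 := h.2
  have hu : IsUnit (PadicInt.toZMod h.1.1.det) :=
    ((Matrix.isUnit_iff_isUnit_det _).1 h.1.isUnit).map _
  have h1 := hu.ne_zero
  rw [Matrix.det_fin_two, map_sub, map_mul, map_mul, h0, mul_zero, sub_zero] at h1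
  exact ⟨left_ne_zero_of_mul h1, right_ne_zero_of_mul h1⟩

/-- The permutation `x ↦ u x + t` of `𝔽_p`, for `u ≠ 0`. -/
def affPerm (u t : ZMod p) (hu : u ≠ 0) : Equiv.Perm (ZMod p) :=
  (Equiv.mulLeft₀ u hu).trans (Equiv.addRight t)

lemma affPerm_apply (u t : ZMod p) (hu : u ≠ 0) (x : ZMod p) : affPerm p u t hu x = u * x + t := rfl

lemma upVec_equivariant (r : ℕ) (h : IZ p) (v : k) :
    upVec p k r (dChar p k r h v) = cInd (IZ p) (dChar p k r) h (upVec p k r v) := by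
  obtain ⟨_, ⟨⟨h, n⟩, rfl⟩⟩ := h
  have h0 : PadicInt.toZMod (h.1.1 1 0) = 0 := h.2
  obtain ⟨ha, hd⟩ := I_diag p h
  have eh : h.1.1 = !![h.1.1 0 0, h.1.1 0 1; h.1.1 1 0, h.1.1 1 1] := Matrix.eta_fin_two _
  rw [dChar_apply, upVec, LinearMap.sum_apply, LinearMap.sum_apply, map_sum]
  symm
  refine Fintype.sum_equiv
    (affPerm p (PadicInt.toZMod (h.1.1 0 0) / PadicInt.toZMod (h.1.1 1 1))
      (PadicInt.toZMod (h.1.1 0 1) / PadicInt.toZMod (h.1.1 1 1)) (div_ne_zero ha hd)) _ _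
      fun x => ?_
  set y := affPerm p (PadicInt.toZMod (h.1.1 0 0) / PadicInt.toZMod (h.1.1 1 1))
      (PadicInt.toZMod (h.1.1 0 1) / PadicInt.toZMod (h.1.1 1 1)) (div_ne_zero ha hd) x with hy
  have hy' : y * PadicInt.toZMod (h.1.1 1 1) =
      PadicInt.toZMod (h.1.1 0 0) * x + PadicInt.toZMod (h.1.1 0 1) := by
    rw [hy, affPerm_apply]
    field_simp
  obtain ⟨κ', h1, -⟩ := exists_conj p (det_upMat p x) (det_upMat p y) h.1 (by
    intro i j
    rw [eh]
    fin_cases i <;> fin_cases j <;>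
    simp [upMat, Matrix.adjugate_fin_two, toZMod_teich, h0]
    linear_combination -hy')
  have e10 : κ'.1 1 0 = h.1.1 1 0 * p := by
    have := congrArg (fun M : Matrix (Fin 2) (Fin 2) ℤ_[p] => M 1 0) h1
    simpa [upMat, Matrix.mul_apply, Fin.sum_univ_two] using this.symm
  have e11 : κ'.1 1 1 = h.1.1 1 0 * teich p x + h.1.1 1 1 := by
    have := congrArg (fun M : Matrix (Fin 2) (Fin 2) ℤ_[p] => M 1 1) h1
    simpa [upMat, Matrix.mul_apply, Fin.sum_univ_two] using this.symm
  have hκ' : κ' ∈ I p := by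
    change PadicInt.toZMod (κ'.1 1 0) = 0
    rw [e10, map_mul, h0, zero_mul]
  change cInd (IZ p) (dChar p k r) (IpToG p (h, n)) (bracket _ _ (toG p _ _) v) = _
  rw [cInd_IZ_bracket p k r _ (by rw [det_upMat]; exact pInt_ne_zero p) h ⟨κ', hκ'⟩ n h1]
  simp only [e11, redk, RingHom.comp_apply, map_add, map_mul, h0, zero_mul, zero_add, map_zero]
  rfl

lemma lowVec_equivariant (r : ℕ) (h : IZ p) (v : k) :
    lowVec p k r (dChar p k r h v) = cInd (IZ p) (dChar p k r) h (lowVec p k r v) := by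
  obtain ⟨_, ⟨⟨h, n⟩, rfl⟩⟩ := h
  have h0 : PadicInt.toZMod (h.1.1 1 0) = 0 := h.2
  obtain ⟨c, hc⟩ := exists_eq_p_mul p h0
  obtain ⟨ha, hd⟩ := I_diag p h
  have eh : h.1.1 = !![h.1.1 0 0, h.1.1 0 1; h.1.1 1 0, h.1.1 1 1] := Matrix.eta_fin_two _
  rw [dChar_apply, lowVec, LinearMap.sum_apply, LinearMap.sum_apply, map_sum]
  symm
  refine Fintype.sum_equiv
    (affPerm p (PadicInt.toZMod (h.1.1 1 1) / PadicInt.toZMod (h.1.1 0 0))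
      (PadicInt.toZMod c / PadicInt.toZMod (h.1.1 0 0)) (div_ne_zero hd ha)) _ _
      fun x => ?_
  set y := affPerm p (PadicInt.toZMod (h.1.1 1 1) / PadicInt.toZMod (h.1.1 0 0))
      (PadicInt.toZMod c / PadicInt.toZMod (h.1.1 0 0)) (div_ne_zero hd ha) x with hy
  have hy' : y * PadicInt.toZMod (h.1.1 0 0) =
      PadicInt.toZMod (h.1.1 1 1) * x + PadicInt.toZMod c := by
    rw [hy, affPerm_apply]
    field_simp
  obtain ⟨κ', h1, -⟩ := exists_conj p (det_lowMat p x) (det_lowMat p y) h.1 (by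
    intro i j
    rw [eh]
    fin_cases i <;> fin_cases j <;>
    simp [lowMat, Matrix.adjugate_fin_two, toZMod_teich, h0])
  have hp := pInt_ne_zero p
  have e00 : κ'.1 0 0 = h.1.1 0 0 + h.1.1 0 1 * (p * teich p x) := by
    have := congrArg (fun M : Matrix (Fin 2) (Fin 2) ℤ_[p] => M 0 0) h1
    simpa [lowMat, Matrix.mul_apply, Fin.sum_univ_two] using this.symm
  have e01 : κ'.1 0 1 = h.1.1 0 1 * p := by
    have := congrArg (fun M : Matrix (Fin 2) (Fin 2) ℤ_[p] => M 0 1) h1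
    simpa [lowMat, Matrix.mul_apply, Fin.sum_univ_two] using this.symm
  have e10 : κ'.1 1 0 = c + h.1.1 1 1 * teich p x - teich p y * κ'.1 0 0 := by
    have := congrArg (fun M : Matrix (Fin 2) (Fin 2) ℤ_[p] => M 1 0) h1
    simp only [lowMat, Matrix.mul_apply, Fin.sum_univ_two, hc] at this
    refine mul_left_cancel₀ hp ?_
    simp at this
    linear_combination -this
  have e11 : κ'.1 1 1 = h.1.1 1 1 - teich p y * κ'.1 0 1 := by
    have := congrArg (fun M : Matrix (Fin 2) (Fin 2) ℤ_[p] => M 1 1) h1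
    simp only [lowMat, Matrix.mul_apply, Fin.sum_univ_two] at this
    refine mul_left_cancel₀ hp ?_
    simp at this
    linear_combination -this
  have hκ' : κ' ∈ I p := by
    change PadicInt.toZMod (κ'.1 1 0) = 0
    rw [e10, e00]
    simp [toZMod_teich]
    linear_combination -hy'
  change cInd (IZ p) (dChar p k r) (IpToG p (h, n)) (bracket _ _ (toG p _ _) v) = _
  rw [cInd_IZ_bracket p k r _ (by rw [det_lowMat]; exact pInt_ne_zero p) h ⟨κ', hκ'⟩ n h1]
  have e : redk p k (κ'.1 1 1) = redk p k (h.1.1 1 1) := by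
    rw [e11, e01]
    simp [redk]
  simp only [e]
  rfl

lemma redk_pow_eq_one (r : ℕ) (hr : (p - 1) ∣ r) (x : ℤ_[p]) (hx : PadicInt.toZMod x ≠ 0) :
    redk p k x ^ r = 1 := by
  obtain ⟨m, rfl⟩ := hr
  rw [redk, RingHom.comp_apply, ← map_pow, pow_mul, ZMod.pow_card_sub_one_eq_one hx, one_pow,
    map_one]

lemma betaVec_equivariant (r : ℕ) (hr : (p - 1) ∣ r) (h : IZ p) (v : k) :
    bracket (IZ p) (dChar p k r) (beta p) (dChar p k r h v) =
      cInd (IZ p) (dChar p k r) h (bracket (IZ p) (dChar p k r) (beta p) v) := by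
  obtain ⟨_, ⟨⟨h, n⟩, rfl⟩⟩ := h
  have h0 : PadicInt.toZMod (h.1.1 1 0) = 0 := h.2
  obtain ⟨c, hc⟩ := exists_eq_p_mul p h0
  obtain ⟨ha, hd⟩ := I_diag p h
  have eh : h.1.1 = !![h.1.1 0 0, h.1.1 0 1; h.1.1 1 0, h.1.1 1 1] := Matrix.eta_fin_two _
  have hu : IsUnit (!![h.1.1 1 1, c; p * h.1.1 0 1, h.1.1 0 0] : Matrix (Fin 2) (Fin 2) ℤ_[p]) := by
    rw [Matrix.isUnit_iff_isUnit_det]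
    have h2 := (Matrix.isUnit_iff_isUnit_det _).1 h.1.isUnit
    rw [Matrix.det_fin_two, hc] at h2
    rw [Matrix.det_fin_two_of]
    convert h2 using 1
    ring
  have hI : hu.unit ∈ I p := by
    change PadicInt.toZMod ((p : ℤ_[p]) * h.1.1 0 1) = 0
    simp
  change _ = cInd (IZ p) (dChar p k r) (IpToG p (h, n)) (bracket _ _ (toG p _ _) v)
  rw [cInd_IZ_bracket p k r _ (by rw [det_betaMat]; exact neg_ne_zero.2 (pInt_ne_zero p)) h
    ⟨hu.unit, hI⟩ n (B := betaMat p), dChar_apply, redk_pow_eq_one p k r hr _ hd]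
  · have : redk p k ((hu.unit : Matrix (Fin 2) (Fin 2) ℤ_[p]) 1 1) ^ r = 1 :=
      redk_pow_eq_one p k r hr _ ha
    simp only [this]
    rfl
  · change h.1.1 * betaMat p = betaMat p * !![h.1.1 1 1, c; (p : ℤ_[p]) * h.1.1 0 1, h.1.1 0 0]
    ext i j
    fin_cases i <;> fin_cases j <;>
      simp [betaMat, Matrix.mul_apply, Fin.sum_univ_two, hc, mul_comm]

/-- The operator `T_{-1,0}` on `ind_{IZ}^G d^r`, with `T_{-1,0}[[1, v]] = ∑_x [[(p [x]; 0 1), v]]`. -/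
def Tm10 (r : ℕ) :
    (cInd (IZ p) (dChar p k r)).IntertwiningMap (cInd (IZ p) (dChar p k r)) :=
  frob (cInd (IZ p) (dChar p k r)) (upVec p k r) (upVec_equivariant p k r)

/-- The operator `T_{1,2}` on `ind_{IZ}^G d^r`, with `T_{1,2}[[1, v]] = ∑_x [[(1 0; p[x] p), v]]`. -/
def T12 (r : ℕ) :
    (cInd (IZ p) (dChar p k r)).IntertwiningMap (cInd (IZ p) (dChar p k r)) :=
  frob (cInd (IZ p) (dChar p k r)) (lowVec p k r) (lowVec_equivariant p k r)

open Classical in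
/-- The operator `T_{1,0}` on `ind_{IZ}^G d^r`, with `T_{1,0}[[1, v]] = [[β, v]]`. It only exists
when `d^r` is trivial, i.e. when `p - 1` divides `r`; otherwise the symbol is given the value `0`
(it then only occurs multiplied by `0`). -/
def T10 (r : ℕ) :
    (cInd (IZ p) (dChar p k r)).IntertwiningMap (cInd (IZ p) (dChar p k r)) :=
  if hr : (p - 1) ∣ r then
    frob (cInd (IZ p) (dChar p k r)) (bracket (IZ p) (dChar p k r) (beta p))
      (betaVec_equivariant p k r hr)
  else 0

end Hecke

section Automorphic

variable (p : ℕ) [Fact p.Prime] (k : Type*) [Field k] [Algebra (ZMod p) k]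

/-- `π(r, λ, η) = (ind_{KZ}^G V_r / (T - λ)) ⊗ (η ∘ det)`. -/
def piRep (r : ℕ) (l : k) (η : ℚ_[p]ˣ →* kˣ) :=
  twist (η.comp Matrix.GeneralLinearGroup.det)
    (quotRep (T p k r - l • Representation.IntertwiningMap.id (cInd (KZ p) (symRep p k r))).range)

/-- `(ind_{IZ}^G d^r / ((T_{-1,0} + δ_{r,p-1} T_{1,0}) + (T_{1,2} + δ_{r,0} T_{1,0} - λ))) ⊗ (η ∘ det)`,
where `(A) + (B)` is the sum of the images of the operators `A` and `B`. -/
def iwRep (r : ℕ) (l : k) (η : ℚ_[p]ˣ →* kˣ) :=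
  twist (η.comp Matrix.GeneralLinearGroup.det)
    (quotRep ((Tm10 p k r + (if r = p - 1 then 1 else 0 : k) • T10 p k r).range ⊔
      (T12 p k r + (if r = 0 then 1 else 0 : k) • T10 p k r -
        l • Representation.IntertwiningMap.id (cInd (IZ p) (dChar p k r))).range))

/-- The class `[a] ∈ {0, …, p - 2}` of an integer `a` mod `p - 1`. -/
def cls (a : ℤ) : ℕ := (a % ((p : ℤ) - 1)).toNat

/-- The fundamental character `ω` of level one, as a character of `ℚ_pˣ`: it sends `p` to `1` and
`u ∈ ℤ_pˣ` to `u mod p`. -/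
def omegaQp : ℚ_[p]ˣ →* kˣ := (Units.map (redk p k).toMonoidHom).comp (unitPart p)

end Automorphic

section Galois

variable (p : ℕ) [Fact p.Prime]

/-- `Q̄_p`. -/
abbrev QpBar : Type := AlgebraicClosure ℚ_[p]

/-- `Gal(Q̄_p/ℚ_p)`. -/
abbrev GalQp : Type := Gal(QpBar p/ℚ_[p])

/-- The ring of integers `Z̄_p` of `Q̄_p`. -/
abbrev ZpBar : Subalgebra ℤ_[p] (QpBar p) := integralClosure ℤ_[p] (QpBar p)

variable {p} in
/-- The action of an element of the Galois group on `Z̄_p`. -/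
def galInt (g : GalQp p) : ZpBar p ≃ₐ[ℤ_[p]] ZpBar p :=
  (g.restrictScalars ℤ_[p]).mapIntegralClosure

variable (k : Type*) [Field k] [Algebra (ZMod p) k]

lemma exists_hom_of_integral {F L E : Type*} [Field F] [Field L] [Field E] [IsAlgClosed E]
    [Algebra F L] [Algebra.IsIntegral F L] (f : F →+* E) : Nonempty (L →+* E) := by
  let _ := f.toAlgebra
  have : Algebra.IsAlgebraic F L := Algebra.IsIntegral.isAlgebraic
  exact ⟨(IsAlgClosed.lift : L →ₐ[F] E).toRingHom⟩

/-- `Z̄_p` admits reduction maps to any algebraically closed field of characteristic `p`. -/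
lemma exists_reduction [IsAlgClosed k] : Nonempty (ZpBar p →+* k) := by
  obtain ⟨M, hM⟩ := Ideal.exists_maximal (ZpBar p)
  have hm : (M.under ℤ_[p]).IsMaximal := Ideal.isMaximal_comap_of_isIntegral_of_isMaximal M
  let _ : Field (ℤ_[p] ⧸ M.under ℤ_[p]) := Ideal.Quotient.field _
  let _ : Field (ZpBar p ⧸ M) := Ideal.Quotient.field _
  have hker : ∀ a ∈ M.under ℤ_[p], redk p k a = 0 := by
    intro a ha
    rw [IsLocalRing.eq_maximalIdeal hm, ← PadicInt.ker_toZMod, RingHom.mem_ker] at ha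
    rw [redk, RingHom.comp_apply, ha, map_zero]
  obtain ⟨f⟩ := exists_hom_of_integral (L := ZpBar p ⧸ M) (Ideal.Quotient.lift _ (redk p k) hker)
  exact ⟨f.comp (Ideal.Quotient.mk M)⟩

variable {p k}

/-- The inertia subgroup of `Gal(Q̄_p/ℚ_p)`: automorphisms acting trivially on the residue field
of `Z̄_p`. The latter is embedded in `k` by `red`. -/
def inertia (red : ZpBar p →+* k) : Subgroup (GalQp p) where
  carrier := {g | ∀ x, red (galInt g x) = red x}
  one_mem' := fun x => rfl
  mul_mem' := fun {g h} hg hh x => (hg (galInt h x)).trans (hh x)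
  inv_mem' := by
    intro g hg x
    have := hg (galInt g⁻¹ x)
    rw [← this]
    congr 1
    refine Subtype.ext ?_
    change g (g⁻¹ x.1) = x.1
    simp

/-- `g` is a geometric Frobenius: it induces `x ↦ x^(1/p)` on the residue field. -/
def IsGeomFrob (red : ZpBar p →+* k) (g : GalQp p) : Prop :=
  ∀ x, red (galInt g x) ^ p = red x

/-- A character of a topological group is smooth if its kernel is open. -/
def IsSmoothChar {Γ : Type*} [Group Γ] [TopologicalSpace Γ] (χ : Γ →* kˣ) : Prop :=
  IsOpen (χ.ker : Set Γ)

variable (p) in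
/-- The `p`-adic cyclotomic character of `Gal(Q̄_p/ℚ_p)`. -/
def cyc : GalQp p →* ℤ_[p]ˣ :=
  (cyclotomicCharacter (QpBar p) p).comp (MulSemiringAction.toRingAut (GalQp p) (QpBar p))

variable (p k) in
/-- `ω` as a character of `Gal(Q̄_p/ℚ_p)`: the mod `p` cyclotomic character, which is the canonical
extension of the fundamental character of level one of inertia. -/
def omegaGal : GalQp p →* kˣ := (Units.map (redk p k).toMonoidHom).comp (cyc p)

variable (p) in
lemma exists_root_p : ∃ ϖ : QpBar p, ϖ ^ (p ^ 2 - 1) = (p : QpBar p) := by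
  have : 0 < p ^ 2 - 1 := by
    have := (Fact.out : p.Prime).two_le
    have : 2 ^ 2 ≤ p ^ 2 := Nat.pow_le_pow_left this 2
    omega
  exact IsAlgClosed.exists_pow_nat_eq _ this

variable (p) in
/-- A root `p^(1/(p²-1))` in `Q̄_p`. -/
def rootP : QpBar p := (exists_root_p p).choose

lemma rootP_quot_pow (g : GalQp p) : (g (rootP p) / rootP p) ^ (p ^ 2 - 1) = 1 := by
  have h : rootP p ^ (p ^ 2 - 1) = (p : QpBar p) := (exists_root_p p).choose_spec
  have hp : (p : QpBar p) ≠ 0 := by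
    exact_mod_cast (Fact.out : p.Prime).ne_zero
  rw [div_pow, ← map_pow, h, map_natCast, div_self hp]

/-- The function `g ↦ g(p^(1/(p²-1))) / p^(1/(p²-1))` with values in the roots of unity of order
dividing `p² - 1` in `Z̄_p`, followed by reduction. Its restriction to inertia is the
fundamental character `ω₂` of level two. -/
def omegaTwo (red : ZpBar p →+* k) (g : GalQp p) : k :=
  red ⟨g (rootP p) / rootP p, by
    refine IsIntegral.of_pow (n := p ^ 2 - 1) ?_ ?_
    · have := (Fact.out : p.Prime).two_le
      have : 2 ^ 2 ≤ p ^ 2 := Nat.pow_le_pow_left this 2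
      omega
    · rw [rootP_quot_pow]
      exact isIntegral_one⟩

variable (p) in
/-- The unramified quadratic extension `ℚ_{p²}` of `ℚ_p`, generated by the roots of unity of order
dividing `p² - 1`. -/
def Qp2 : IntermediateField ℚ_[p] (QpBar p) :=
  IntermediateField.adjoin ℚ_[p] {x | x ^ (p ^ 2 - 1) = 1}

variable (p) in
/-- `Gal(Q̄_p/ℚ_{p²})`. -/
def GalQp2 : Subgroup (GalQp p) := (Qp2 p).fixingSubgroup

/-- The representation of `Gal(Q̄_p/ℚ_p)` induced from a character of `Gal(Q̄_p/ℚ_{p²})`. -/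
def indChar (χ : GalQp2 p →* kˣ) :=
  Representation.coind (GalQp2 p).subtype (charRep χ)

/-- `χ` is the chosen extension of `ω₂^c` to `Gal(Q̄_p/ℚ_{p²})`: a smooth character
extending `ω₂^c` such that the induced representation has determinant `ω^c`. -/
def IsExtOmegaTwo (red : ZpBar p →+* k) (c : ℕ) (χ : GalQp2 p →* kˣ) : Prop :=
  IsSmoothChar χ ∧ (∀ g : GalQp2 p, (g : GalQp p) ∈ inertia red → (χ g : k) = omegaTwo red g ^ c) ∧
    ∀ g, LinearMap.det (indChar χ g) = ((omegaGal p k g) ^ c : kˣ)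

/-- `χ = μ_a`: the smooth unramified character sending a geometric Frobenius to `a`. -/
def IsUnramifiedChar (red : ZpBar p →+* k) (a : k) (χ : GalQp p →* kˣ) : Prop :=
  IsSmoothChar χ ∧ (∀ g ∈ inertia red, χ g = 1) ∧ ∀ g, IsGeomFrob red g → (χ g : k) = a

/-- `χ` is the character of `Gal(Q̄_p/ℚ_p)` corresponding to the smooth character `η` of `ℚ_pˣ` by
local class field theory, normalised so that uniformisers correspond to geometric Frobenius
elements. Explicitly, `u ∈ ℤ_pˣ` corresponds to the elements of inertia with cyclotomic character
`u`, and `p` to the geometric Frobenius elements that act trivially on the roots of unity of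
`p`-power order. -/
def IsArtinChar (red : ZpBar p →+* k) (η : ℚ_[p]ˣ →* kˣ) (χ : GalQp p →* kˣ) : Prop :=
  IsSmoothChar χ ∧
    (∀ g ∈ inertia red, χ g = η (Units.map PadicInt.Coe.ringHom.toMonoidHom (cyc p g))) ∧
    ∀ g, IsGeomFrob red g → cyc p g = 1 → χ g = η (pUnit p)

end Galois

section Correspondence

variable {p : ℕ} [Fact p.Prime] {k : Type*} [Field k] [Algebra (ZMod p) k]
  {W : Type*} [AddCommGroup W] [Module k W] {U : Type*} [AddCommGroup U] [Module k U]

/-- The Galois side of the correspondence at `(r, λ, η)`: the representation `ρ` is isomorphic to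
`(ind ω₂^(r+1)) ⊗ η` if `λ = 0`, and to `(μ_λ ω^(r+1) ⊕ μ_{λ⁻¹}) ⊗ η` if `λ ≠ 0`. -/
def IsGaloisParam (red : ZpBar p →+* k) (r : ℕ) (l : k) (η : ℚ_[p]ˣ →* kˣ)
    (ρ : Representation k (GalQp p) W) : Prop :=
  (l = 0 → ∃ (χ : GalQp p →* kˣ) (ψ : GalQp2 p →* kˣ), IsArtinChar red η χ ∧
    IsExtOmegaTwo red (r + 1) ψ ∧ Nonempty (ρ.Equiv (twist χ (indChar ψ)))) ∧
  (l ≠ 0 → ∃ χ μ μ' : GalQp p →* kˣ, IsArtinChar red η χ ∧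
    IsUnramifiedChar red l μ ∧ IsUnramifiedChar red l⁻¹ μ' ∧
    Nonempty (ρ.Equiv (twist χ ((charRep (μ * omegaGal p k ^ (r + 1))).prod (charRep μ')))))

/-- Breuil's semisimple mod `p` local Langlands correspondence at `(r, λ, η)`, as a relation between
representations `ρ` of `Gal(Q̄_p/ℚ_p)` and `P` of `G`. -/
def BreuilLLC (red : ZpBar p →+* k) (r : ℕ) (l : k) (η : ℚ_[p]ˣ →* kˣ)
    (ρ : Representation k (GalQp p) W) (P : Representation k (G p) U) : Prop :=
  IsGaloisParam red r l η ρ ∧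
  (l = 0 → Nonempty (P.Equiv (piRep p k r 0 η))) ∧
  (l ≠ 0 → IsSumOfSemisimplifications P (piRep p k r l η)
    (piRep p k (cls p (p - 3 - r)) l⁻¹ (η * omegaQp p k ^ (r + 1))))

/-- The Iwahori-theoretic correspondence at `(r, λ, η)`. -/
def IwahoriLLC (red : ZpBar p →+* k) (r : ℕ) (l : k) (η : ℚ_[p]ˣ →* kˣ)
    (ρ : Representation k (GalQp p) W) (P : Representation k (G p) U) : Prop :=
  IsGaloisParam red r l η ρ ∧
  (l = 0 → Nonempty (P.Equiv (iwRep p k r 0 η))) ∧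
  (l ≠ 0 → IsSumOfSemisimplifications P (iwRep p k r l η)
    (iwRep p k (cls p (p - 3 - r)) l⁻¹ (η * omegaQp p k ^ (r + 1))))

end Correspondence

end ModpLLC

end

/-!
For `x ∈ 𝔽_p` put `κ_x = ([x] 1; 1 0) ∈ K`; the `κ_x` and `1` represent `K / I`, and
`(p [x]; 0 1) = κ_x β`, `(1 0; p[x] p) = β κ_x`, `α = β κ_0`, `β² = p`.

The vector `[β, X^r]` of `ind_{KZ}^G V_r` transforms under `IZ` by `d^r`, since `X^r` transforms
under `I` by `a^r` and `β` exchanges the two diagonal entries. Frobenius reciprocity gives a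
`G`-map `ψ : ind_{IZ}^G d^r → ind_{KZ}^G V_r` with `ψ [[1, 1]] = [β, X^r]` (`psi`), and the
isomorphism is induced by `ψ`. Three facts are needed (`nonempty_equiv_quotRep`).

* `ψ` is surjective, because for `r ≤ p - 1` the vectors `κ_x X^r = (x X + Y)^r` span `V_r`, by a
  Vandermonde argument (`exists_sum_symVec`, `psi_surjective`).
* `ψ (T_{1,2} + δ_{r,0} T_{1,0}) = T ψ`. Evaluated at `[[1, 1]]`, both sides are
  `∑ₓ [β κ_x β, X^r] + δ_{r,0} [1, X^r]` (`psi_opS`).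
* The kernel of `ψ` is the image of `T_{-1,0} + δ_{r,p-1} T_{1,0}`. The image is killed since
  `∑ₓ (x X + Y)^r + δ_{r,p-1} X^r = 0` (`psi_opN`). For the converse, a relation
  `∑ₓ c(x) (x X + Y)^r + c' X^r = 0` means that `c` is a polynomial function of degree at most
  `p - 1 - r` with coefficient `c'` in that degree; such pairs `(c, c')` are spanned by the
  `((z - y)^(p-1-r), 1)` for `y ∈ 𝔽_p` (`exists_combination_of_moments`), and these come from the
  translates by `κ_y` of `(T_{-1,0} + δ_{r,p-1} T_{1,0}) [[1, 1]]` (`sum_kap_mul`). Hence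
  `κ X^r ↦ κ [[β, 1]]` defines a map from `V_r` to the quotient of `ind_{IZ}^G d^r` by the image.
  The `G`-map it induces on `ind_{KZ}^G V_r` is a left inverse of `ψ` modulo the image, so that
  the kernel of `ψ` is no larger (`mem_range_opN_of_psi_eq_zero`).

The two correspondences have the same Galois side, and on the automorphic side composition series
are transported along the isomorphisms at `(r, λ, η)` and `([p-3-r], λ⁻¹, η ω^(r+1))`
(`IsSumOfSemisimplifications.congr`).
-/

noncomputable section

namespace ModpLLC

/-! ### Linear algebra of functions on `𝔽_p` -/

section FunctionsOnFp

variable (p : ℕ) [Fact p.Prime]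

lemma sum_pow_card_sub_one : ∑ z : ZMod p, z ^ (p - 1) = -1 := by
  have hp := (Fact.out : p.Prime).two_le
  have h : ∀ z : ZMod p, z ^ (p - 1) = 1 - if z = 0 then 1 else 0 := by
    intro z
    split_ifs with hz
    · rw [hz, zero_pow (by omega), sub_self]
    · rw [ZMod.pow_card_sub_one_eq_one hz, sub_zero]
  simp [h]

lemma sum_pow_add {i j : ℕ} (hi : i ≤ p - 1) (hj : j ≤ p - 1) :
    ∑ z : ZMod p, z ^ (i + j) =
      (if i = p - 1 - j then -1 else 0) + if i = p - 1 ∧ j = p - 1 then -1 else 0 := by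
  have hp := (Fact.out : p.Prime).two_le
  rcases lt_trichotomy (i + j) (p - 1) with h | h | h
  · rw [FiniteField.sum_pow_lt_card_sub_one (ZMod p) _ (by rwa [ZMod.card]), if_neg (by omega),
      if_neg (by omega), add_zero]
  · rw [h, sum_pow_card_sub_one, if_pos (by omega), if_neg (by omega), add_zero]
  · have e : ∀ z : ZMod p, z ^ (i + j) = z ^ (i + j - (p - 1)) := by
      intro z
      have e1 : i + j = (i + j - p) + p := by omega
      have e2 : i + j - (p - 1) = (i + j - p) + 1 := by omega
      rw [e2, e1, pow_add, ZMod.pow_card, pow_succ, Nat.add_sub_cancel]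
    simp only [e]
    rw [if_neg (by omega), zero_add]
    split_ifs with h'
    · rw [h'.1, h'.2, Nat.add_sub_cancel, sum_pow_card_sub_one]
    · exact FiniteField.sum_pow_lt_card_sub_one (ZMod p) _ (by rw [ZMod.card]; omega)

variable {k : Type*} [Field k] [Algebra (ZMod p) k]

lemma sum_algebraMap_pow_add {i j : ℕ} (hi : i ≤ p - 1) (hj : j ≤ p - 1) :
    ∑ z : ZMod p, algebraMap (ZMod p) k z ^ (i + j) =
      (if i = p - 1 - j then -1 else 0) + if i = p - 1 ∧ j = p - 1 then -1 else 0 := by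
  have h := congrArg (algebraMap (ZMod p) k) (sum_pow_add p hi hj)
  simpa only [map_sum, map_pow, map_add, apply_ite (algebraMap (ZMod p) k), map_neg, map_one,
    map_zero] using h

variable (k) in
/-- The Vandermonde matrix `(z ^ j)`, with `z ∈ 𝔽_p` (in some order) and `0 ≤ j < p`. -/
def vander : Matrix (Fin p) (Fin p) k :=
  Matrix.vandermonde fun i => algebraMap (ZMod p) k (ZMod.finEquiv p i)

lemma isUnit_vander : IsUnit (vander p k) := by
  rw [Matrix.isUnit_iff_isUnit_det, isUnit_iff_ne_zero]
  exact Matrix.det_vandermonde_ne_zero_iff.2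
    ((algebraMap (ZMod p) k).injective.comp (ZMod.finEquiv p).injective)

/-- The moments of order less than `p` of a function on `𝔽_p` can be prescribed. -/
lemma exists_moments (b : ℕ → k) :
    ∃ d : ZMod p → k, ∀ j < p, ∑ y, d y * algebraMap (ZMod p) k y ^ j = b j := by
  obtain ⟨v, hv⟩ := Matrix.vecMul_surjective_iff_isUnit.2 (isUnit_vander p (k := k))
    (fun j => b j)
  refine ⟨fun y => v ((ZMod.finEquiv p).symm y), fun j hj => ?_⟩
  rw [← congrFun hv ⟨j, hj⟩]
  refine (Fintype.sum_equiv (ZMod.finEquiv p).toEquiv _ _ fun i => ?_).symm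
  simp [vander, Matrix.vandermonde_apply]

/-- Every function on `𝔽_p` is a polynomial of degree less than `p`. -/
lemma exists_polynomial (c : ZMod p → k) :
    ∃ a : ℕ → k, ∀ z, c z = ∑ i ∈ Finset.range p, a i * algebraMap (ZMod p) k z ^ i := by
  obtain ⟨v, hv⟩ := Matrix.mulVec_surjective_iff_isUnit.2 (isUnit_vander p (k := k))
    (fun i => c (ZMod.finEquiv p i))
  refine ⟨fun i => if h : i < p then v ⟨i, h⟩ else 0, fun z => ?_⟩
  have := congrFun hv ((ZMod.finEquiv p).symm z)
  rw [RingEquiv.apply_symm_apply] at this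
  rw [← this, Finset.sum_range]
  simp [vander, Matrix.mulVec, dotProduct, Matrix.vandermonde_apply, mul_comm]

lemma moment_polynomial (a : ℕ → k) {j : ℕ} (hj : j ≤ p - 1) :
    ∑ z : ZMod p, (∑ i ∈ Finset.range p, a i * algebraMap (ZMod p) k z ^ i) *
      algebraMap (ZMod p) k z ^ j = -a (p - 1 - j) - if j = p - 1 then a (p - 1) else 0 := by
  have hp := (Fact.out : p.Prime).two_le
  simp only [Finset.sum_mul, mul_assoc, ← pow_add]
  rw [Finset.sum_comm]
  simp only [← Finset.mul_sum]
  rw [Finset.sum_congr rfl fun i hi => by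
    rw [sum_algebraMap_pow_add p (by have := Finset.mem_range.1 hi; omega) hj]]
  simp only [mul_add, Finset.sum_add_distrib, mul_ite, mul_neg, mul_one, mul_zero, ite_and]
  rw [Finset.sum_ite_eq', Finset.sum_ite_eq', if_pos (Finset.mem_range.2 (by omega)),
    if_pos (Finset.mem_range.2 (by omega))]
  split_ifs <;> ring

lemma choose_ne_zero {n i : ℕ} (hn : n ≤ p - 1) (hi : i ≤ n) : (n.choose i : k) ≠ 0 := by
  have hp := (Fact.out : p.Prime).two_le
  intro h0
  rw [← map_natCast (algebraMap (ZMod p) k), map_eq_zero, ZMod.natCast_eq_zero_iff] at h0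
  have h1 : p ∣ n.factorial := by
    rw [← Nat.choose_mul_factorial_mul_factorial hi, mul_assoc]
    exact h0.mul_right _
  have := ((Fact.out : p.Prime).dvd_factorial).1 h1
  omega

/-- The relations among the vectors `(x X + Y) ^ r`, `x ∈ 𝔽_p`, and `X ^ r` are spanned by the
relations with coefficients `(z - y) ^ (p - 1 - r)` at `(z X + Y) ^ r` and `1` at `X ^ r`, for
`y ∈ 𝔽_p`. A relation is, by its vanishing moments, a polynomial in `z` of degree at most
`p - 1 - r` whose coefficient of degree `p - 1 - r` is the coefficient at `X ^ r`. -/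
lemma exists_combination_of_moments {r : ℕ} (hr : r ≤ p - 1) (c : ZMod p → k) (c' : k)
    (h : ∀ j ≤ r, ∑ z, c z * algebraMap (ZMod p) k z ^ j + (if j = r then c' else 0) = 0) :
    ∃ d : ZMod p → k, c' = ∑ y, d y ∧
      ∀ z, c z = ∑ y, d y * (algebraMap (ZMod p) k (z - y)) ^ (p - 1 - r) := by
  have hp := (Fact.out : p.Prime).two_le
  obtain ⟨a, ha⟩ := exists_polynomial p c
  have h1 : ∀ j ≤ r, -a (p - 1 - j) - (if j = p - 1 then a (p - 1) else 0) +
      (if j = r then c' else 0) = 0 := by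
    intro j hj
    have := h j hj
    simp only [ha] at this
    rwa [moment_polynomial p a (by omega)] at this
  have htop : 0 < r → a (p - 1) = 0 := by
    intro h0
    have := h1 0 (by omega)
    rw [if_neg (by omega), if_neg (by omega)] at this
    simpa using this
  have hvan : ∀ i, p - 1 - r < i → i ≤ p - 1 → a i = 0 := by
    intro i hi hi'
    have := h1 (p - 1 - i) (by omega)
    rw [if_neg (by omega : ¬ p - 1 - i = r), show p - 1 - (p - 1 - i) = i by omega] at this
    split_ifs at this with h2
    · rw [htop (by omega)] at this
      simpa using this
    · simpa using this
  have hc' : c' = a (p - 1 - r) := by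
    have := h1 r le_rfl
    rw [if_pos rfl] at this
    split_ifs at this with h2
    · rw [htop (by omega)] at this
      linear_combination this
    · linear_combination this
  set m := p - 1 - r with hm
  have hch : ∀ i ≤ m, (m.choose i : k) ≠ 0 := fun i hi => choose_ne_zero p (by omega) hi
  -- Expanding `(z - y) ^ m` in powers of `z`, the coefficients of `∑ y, d y * (z - y) ^ m` are the
  -- moments of `d`, up to signs and binomial coefficients.
  obtain ⟨d, hd⟩ := exists_moments p
    (fun j => (-1) ^ j * a (m - j) / (m.choose (m - j) : k))
  refine ⟨d, ?_, fun z => ?_⟩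
  · have := hd 0 (by omega)
    simp only [pow_zero, mul_one, Nat.sub_zero, one_mul, Nat.choose_self, Nat.cast_one,
      div_one] at this
    rw [this, hc']
  · have e : ∀ y : ZMod p, d y * algebraMap (ZMod p) k (z - y) ^ m =
        ∑ i ∈ Finset.range (m + 1), algebraMap (ZMod p) k z ^ i * (-1) ^ (m - i) *
          (m.choose i : k) * (d y * algebraMap (ZMod p) k y ^ (m - i)) := by
      intro y
      rw [map_sub, sub_eq_add_neg, add_pow, Finset.mul_sum]
      refine Finset.sum_congr rfl fun i _ => ?_
      rw [neg_pow]
      ring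
    simp only [e]
    have hsub : Finset.range p = Finset.range ((m + 1) + r) := congrArg _ (by omega)
    rw [Finset.sum_comm, ha z, hsub, Finset.sum_range_add,
      Finset.sum_eq_zero (s := Finset.range r) fun i hi => ?_, add_zero]
    · refine Finset.sum_congr rfl fun i hi => ?_
      have hi' := Finset.mem_range.1 hi
      rw [← Finset.mul_sum, hd (m - i) (by omega), show m - (m - i) = i by omega]
      have := hch i (by omega)
      have h2 : ((-1 : k) ^ (m - i)) * (-1) ^ (m - i) = 1 := by
        rw [← mul_pow]; simp
      field_simp
      linear_combination (-(algebraMap (ZMod p) k z ^ i * a i)) * h2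
    · rw [hvan _ (by omega) (by have := Finset.mem_range.1 hi; omega), zero_mul]

end FunctionsOnFp

/-! ### Generation of compact inductions and Hecke quotients -/

section Representations

variable {k Γ V W : Type*} [Field k] [Group Γ] [AddCommGroup V] [Module k V]
  [AddCommGroup W] [Module k W]

lemma bracket_one_equivariant {H : Subgroup Γ} {σ : Representation k H V} (h : H) (v : V) :
    bracket H σ 1 (σ h v) = cInd H σ h (bracket H σ 1 v) := by
  rw [cInd_bracket, ← bracket_mul, one_mul, mul_one]

lemma eq_finsum_liftTerm {H : Subgroup Γ} {σ : Representation k H V} (f : CInd H σ) :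
    f = ∑ᶠ q, liftTerm (σ := σ) (π := cInd H σ) bracket_one_equivariant f q := by
  classical
  ext g
  let ev : CInd H σ →ₗ[k] V := (LinearMap.proj g).comp (cIndSub H σ).subtype
  change ev f = ev (∑ᶠ q, liftTerm (σ := σ) (π := cInd H σ) bracket_one_equivariant f q)
  rw [show ev (∑ᶠ q, liftTerm (σ := σ) (π := cInd H σ) bracket_one_equivariant f q) =
      ∑ᶠ q, ev (liftTerm (σ := σ) (π := cInd H σ) bracket_one_equivariant f q) from
    ev.toAddMonoidHom.map_finsum (liftTerm_finite bracket_one_equivariant f),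
    finsum_eq_single _ ((g⁻¹ : Γ) : Γ ⧸ H)]
  · rw [liftTerm_mk]
    change f.1 g = (bracket H σ 1 (f.1 g⁻¹⁻¹)).1 (g * g⁻¹)
    have e : (⟨g * g⁻¹ * 1, by simp⟩ : H) = 1 := Subtype.ext (by simp)
    rw [bracket_apply, dif_pos (by simp), e, map_one, inv_inv]
    rfl
  · intro q hq
    induction q using QuotientGroup.induction_on with
    | H x =>
      rw [liftTerm_mk]
      change (bracket H σ 1 (f.1 x⁻¹)).1 (g * x) = 0
      rw [bracket_apply, dif_neg]
      intro hx
      refine hq (QuotientGroup.eq.2 ?_)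
      have := H.inv_mem hx
      rwa [mul_one, mul_inv_rev] at this

/-- The functions `[g, v]` span the compact induction. -/
lemma mem_of_bracket_mem {H : Subgroup Γ} {σ : Representation k H V}
    (U : Submodule k (CInd H σ)) (hU : ∀ g v, bracket H σ g v ∈ U) (f : CInd H σ) : f ∈ U := by
  rw [eq_finsum_liftTerm f]
  refine finsum_induction (· ∈ U) U.zero_mem (fun _ _ => U.add_mem) fun q => ?_
  induction q using QuotientGroup.induction_on with
  | H x =>
    rw [liftTerm_mk, cInd_bracket]
    exact hU _ _

/-- The uniqueness part of Frobenius reciprocity. -/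
lemma cInd_hom_ext {H : Subgroup Γ} {σ : Representation k H V} {π : Representation k Γ W}
    {A B : (cInd H σ).IntertwiningMap π}
    (h : ∀ v, A (bracket H σ 1 v) = B (bracket H σ 1 v)) (f : CInd H σ) : A f = B f := by
  refine mem_of_bracket_mem (LinearMap.eqLocus A.toLinearMap B.toLinearMap) (fun g v => ?_) f
  change A (bracket H σ g v) = B (bracket H σ g v)
  have e : bracket H σ g v = cInd H σ g (bracket H σ 1 v) := by rw [cInd_bracket, mul_one]
  rw [e, A.isIntertwining, B.isIntertwining, h]

/-- A surjection `ψ` intertwining `S` with `T` and having kernel the image of `N` identifies the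
cokernel of `T - l` with the quotient by `(N) + (S - l)`. -/
lemma nonempty_equiv_quotRep {ρ : Representation k Γ V} {τ : Representation k Γ W}
    (ψ : ρ.IntertwiningMap τ) (N S : ρ.IntertwiningMap ρ) (T : τ.IntertwiningMap τ) (l : k)
    (χ : Γ →* kˣ) (hψ : Function.Surjective ψ) (hN : ∀ v, ψ (N v) = 0)
    (hker : ∀ v, ψ v = 0 → v ∈ N.range) (hS : ∀ v, ψ (S v) = T (ψ v)) :
    Nonempty ((twist χ (quotRep (T - l • Representation.IntertwiningMap.id τ).range)).Equiv
      (twist χ (quotRep (N.range ⊔ (S - l • Representation.IntertwiningMap.id ρ).range)))) := by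
  set U := N.range ⊔ (S - l • Representation.IntertwiningMap.id ρ).range with hU
  set R := (T - l • Representation.IntertwiningMap.id τ).range with hR
  have hc : ∀ v, ψ ((S - l • Representation.IntertwiningMap.id ρ) v) =
      (T - l • Representation.IntertwiningMap.id τ) (ψ v) := by
    intro v
    change ψ (S v - l • v) = T (ψ v) - l • ψ v
    rw [map_sub, map_smul, hS]
  have hle : U.toSubmodule ≤ R.toSubmodule.comap ψ.toLinearMap := by
    rw [hU, Subrepresentation.toSubmodule_sup]
    refine sup_le ?_ ?_
    · rintro _ ⟨v, rfl⟩
      change ψ (N v) ∈ R.toSubmodule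
      rw [hN]
      exact R.toSubmodule.zero_mem
    · rintro _ ⟨v, rfl⟩
      exact ⟨ψ v, (hc v).symm⟩
  let m : (V ⧸ U.toSubmodule) →ₗ[k] (W ⧸ R.toSubmodule) :=
    Submodule.mapQ U.toSubmodule R.toSubmodule ψ.toLinearMap hle
  have hm : Function.Bijective m := by
    constructor
    · rw [← LinearMap.ker_eq_bot, Submodule.eq_bot_iff]
      intro q hq
      induction q using Submodule.Quotient.induction_on with
      | H v =>
        rw [LinearMap.mem_ker, Submodule.mapQ_apply, Submodule.Quotient.mk_eq_zero] at hq
        obtain ⟨w, hw⟩ := hq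
        obtain ⟨u, rfl⟩ := hψ w
        rw [Submodule.Quotient.mk_eq_zero, hU, Subrepresentation.toSubmodule_sup]
        have h1 : ψ (v - (S - l • Representation.IntertwiningMap.id ρ) u) = 0 := by
          rw [map_sub, hc, sub_eq_zero]
          exact hw.symm
        have h2 := Submodule.add_mem_sup (hker _ h1)
          (show (S - l • Representation.IntertwiningMap.id ρ) u ∈
            (S - l • Representation.IntertwiningMap.id ρ).range.toSubmodule from ⟨u, rfl⟩)
        rwa [sub_add_cancel] at h2
    · intro q
      induction q using Submodule.Quotient.induction_on with
      | H w =>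
        obtain ⟨v, rfl⟩ := hψ w
        exact ⟨Submodule.Quotient.mk v, rfl⟩
  refine ⟨Representation.Equiv.symm (Representation.Equiv.mk (LinearEquiv.ofBijective m hm) ?_)⟩
  intro g
  refine LinearMap.ext fun q => ?_
  induction q using Submodule.Quotient.induction_on with
  | H v =>
    change m ((χ g : k) • Submodule.Quotient.mk (ρ g v)) =
      (χ g : k) • Submodule.Quotient.mk (τ g (ψ v))
    rw [map_smul, ← ψ.isIntertwining]
    rfl

/-! ### Semisimplifications of isomorphic representations -/

/-- An equivalence of representations as an isomorphism of modules over the group algebra. -/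
def asModuleLinearEquiv {ρ : Representation k Γ V} {τ : Representation k Γ W} (e : ρ.Equiv τ) :
    ρ.asModule ≃ₗ[MonoidAlgebra k Γ] τ.asModule :=
  LinearEquiv.ofBijective
    (Representation.IntertwiningMap.equivLinearMapAsModule ρ τ e.toIntertwiningMap)
    e.toLinearEquiv.bijective

/-- The image of a composition series under an isomorphism of modules. -/
def mapSeries {R M M' : Type*} [Ring R] [AddCommGroup M] {_ : Module R M} [AddCommGroup M']
    {_ : Module R M'} (e : M ≃ₗ[R] M') (s : CompositionSeries (Submodule R M)) :
    CompositionSeries (Submodule R M') :=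
  s.map ⟨Submodule.orderIsoMapComap e, fun {a b} (h : a ⋖ b) =>
    (apply_covBy_apply_iff (Submodule.orderIsoMapComap e)).2 h⟩

/-- An isomorphism of modules identifies the graded modules of a composition series and of its
image. -/
def grEquiv {M M' : Type*} [AddCommGroup M] {_ : Module (MonoidAlgebra k Γ) M}
    [AddCommGroup M'] {_ : Module (MonoidAlgebra k Γ) M'} (e : M ≃ₗ[MonoidAlgebra k Γ] M')
    (s : CompositionSeries (Submodule (MonoidAlgebra k Γ) M)) :
    Gr s ≃ₗ[MonoidAlgebra k Γ] Gr (mapSeries e s) :=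
  LinearEquiv.piCongrRight fun i =>
    Submodule.Quotient.equiv _ _ (e.submoduleMap (s i.succ)) (by
      ext ⟨y, hy⟩
      constructor
      · rintro ⟨⟨x, hx⟩, hx', h⟩
        exact ⟨x, hx', congrArg Subtype.val h⟩
      · rintro ⟨x, hx, h⟩
        exact ⟨⟨x, (s.lt_succ i).le hx⟩, hx, Subtype.ext h⟩)

lemma IsSumOfSemisimplifications.congr {U V' W' : Type*} [AddCommGroup U] [Module k U]
    [AddCommGroup V'] [Module k V'] [AddCommGroup W'] [Module k W']
    {P : Representation k Γ U} {ρ : Representation k Γ V} {ρ' : Representation k Γ W}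
    {τ : Representation k Γ V'} {τ' : Representation k Γ W'} (e : ρ.Equiv τ) (e' : ρ'.Equiv τ')
    (h : IsSumOfSemisimplifications P ρ ρ') : IsSumOfSemisimplifications P τ τ' := by
  obtain ⟨s, s', h1, h2, h3, h4, ⟨f⟩⟩ := h
  refine ⟨mapSeries (asModuleLinearEquiv e) s, mapSeries (asModuleLinearEquiv e') s', ?_, ?_, ?_,
    ?_, ⟨f.trans (LinearEquiv.prodCongr (grEquiv _ s) (grEquiv _ s'))⟩⟩
  · exact (congrArg (Submodule.orderIsoMapComap (asModuleLinearEquiv e)) h1).trans (map_bot _)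
  · exact (congrArg (Submodule.orderIsoMapComap (asModuleLinearEquiv e)) h2).trans (map_top _)
  · exact (congrArg (Submodule.orderIsoMapComap (asModuleLinearEquiv e')) h3).trans (map_bot _)
  · exact (congrArg (Submodule.orderIsoMapComap (asModuleLinearEquiv e')) h4).trans (map_top _)

end Representations

/-! ### Matrix identities -/

section Matrices

variable (p : ℕ) [Fact p.Prime]

/-- The matrix `([x] 1; 1 0)` of `K`. Together with the identity, these matrices represent the
cosets in `K / I`, a copy of `ℙ¹(𝔽_p)`. -/
def kap (x : ZMod p) : K p where
  val := !![teich p x, 1; 1, 0]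
  inv := !![0, 1; 1, -teich p x]
  val_inv := by simp [Matrix.one_fin_two]
  inv_val := by simp [Matrix.one_fin_two]

lemma kap_val (x : ZMod p) : (kap p x).1 = !![teich p x, 1; 1, 0] := rfl

lemma kap_inv_val (x : ZMod p) : ((kap p x)⁻¹).1 = !![0, 1; 1, -teich p x] := rfl

lemma teich_zero : teich p 0 = 0 := by
  rw [teich, WittVector.teichmuller_zero, map_zero]

lemma KtoG_mul_eq_toG {A B : Matrix (Fin 2) (Fin 2) ℤ_[p]} (hA : A.det ≠ 0) (hB : B.det ≠ 0)
    {κ : K p} (h : κ.1 * A = B) : KtoG p κ * toG p A hA = toG p B hB := by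
  have := KtoG_mul_toG p hA hB (κ := κ) (κ' := 1) (by rw [h, Units.val_one, mul_one])
  rwa [map_one, mul_one] at this

lemma toG_mul_KtoG_eq {A B : Matrix (Fin 2) (Fin 2) ℤ_[p]} (hA : A.det ≠ 0) (hB : B.det ≠ 0)
    {κ : K p} (h : A * κ.1 = B) : toG p A hA * KtoG p κ = toG p B hB := by
  have := KtoG_mul_toG p hB hA (κ := 1) (κ' := κ) (by rw [h, Units.val_one, one_mul])
  rw [map_one, one_mul] at this
  exact this.symm

lemma up_eq (x : ZMod p) : up p x = KtoG p (kap p x) * beta p := by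
  refine (KtoG_mul_eq_toG p _ _ ?_).symm
  rw [kap_val, betaMat, upMat]
  simp

lemma low_eq (x : ZMod p) : low p x = beta p * KtoG p (kap p x) := by
  refine (toG_mul_KtoG_eq p _ _ ?_).symm
  rw [kap_val, betaMat, lowMat]
  simp

lemma alpha_eq : alpha p = beta p * KtoG p (kap p 0) := by
  refine (toG_mul_KtoG_eq p _ _ ?_).symm
  rw [kap_val, betaMat, alphaMat, teich_zero]
  simp

lemma beta_mul_beta : beta p * beta p = pScalar p := by
  refine Units.ext (Matrix.ext fun i j => ?_)
  change (((betaMat p).map PadicInt.Coe.ringHom) * ((betaMat p).map PadicInt.Coe.ringHom)) i j =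
    Matrix.scalar (Fin 2) (p : ℚ_[p]) i j
  rw [Matrix.scalar_apply]
  fin_cases i <;> fin_cases j <;>
    simp [betaMat, Matrix.mul_apply, Fin.sum_univ_two]

/-- Conjugation by `β` normalises `I` and exchanges the diagonal entries. -/
lemma exists_conj_beta (h : I p) : ∃ h' : I p, h.1.1 * betaMat p = betaMat p * h'.1.1 ∧
    h'.1.1 0 0 = h.1.1 1 1 ∧ h'.1.1 1 1 = h.1.1 0 0 := by
  obtain ⟨c, hc⟩ := exists_eq_p_mul p (show PadicInt.toZMod (h.1.1 1 0) = 0 from h.2)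
  have hu : IsUnit (!![h.1.1 1 1, c; p * h.1.1 0 1, h.1.1 0 0] : Matrix (Fin 2) (Fin 2) ℤ_[p]) := by
    rw [Matrix.isUnit_iff_isUnit_det]
    have h2 := (Matrix.isUnit_iff_isUnit_det _).1 h.1.isUnit
    rw [Matrix.det_fin_two, hc] at h2
    rw [Matrix.det_fin_two_of]
    convert h2 using 1
    ring
  have hI : hu.unit ∈ I p := by
    change PadicInt.toZMod ((p : ℤ_[p]) * h.1.1 0 1) = 0
    simp
  refine ⟨⟨hu.unit, hI⟩, ?_, rfl, rfl⟩
  change h.1.1 * betaMat p = betaMat p * !![h.1.1 1 1, c; (p : ℤ_[p]) * h.1.1 0 1, h.1.1 0 0]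
  ext i j
  fin_cases i <;> fin_cases j <;>
    simp [betaMat, Matrix.mul_apply, Fin.sum_univ_two, hc, mul_comm]

lemma KtoG_mul_beta {h h' : K p} (e : h.1 * betaMat p = betaMat p * h'.1) :
    KtoG p h * beta p = beta p * KtoG p h' :=
  KtoG_mul_toG p _ _ e

/-- The representatives `([x] 1; 1 0)`, `x ∈ 𝔽_p`, and `1` of `K / I`, indexed by `ℙ¹(𝔽_p)`. -/
def cosetRep (x : OnePoint (ZMod p)) : K p := x.elim 1 (kap p)

lemma cosetRep_coe (x : ZMod p) : cosetRep p x = kap p x := rfl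

lemma cosetRep_infty : cosetRep p OnePoint.infty = 1 := rfl

/-- Bruhat decomposition of `GL₂(𝔽_p)`, lifted to `K`. -/
lemma exists_cosetRep_mul (κ : K p) : ∃ (x : OnePoint (ZMod p)) (h : I p),
    κ = cosetRep p x * h.1 := by
  by_cases h0 : PadicInt.toZMod (κ.1 1 0) = 0
  · exact ⟨OnePoint.infty, ⟨κ, h0⟩, by rw [cosetRep_infty, one_mul]⟩
  · set x : ZMod p := PadicInt.toZMod (κ.1 0 0) / PadicInt.toZMod (κ.1 1 0) with hx
    have hI : (kap p x)⁻¹ * κ ∈ I p := by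
      change PadicInt.toZMod ((((kap p x)⁻¹).1 * κ.1) 1 0) = 0
      rw [kap_inv_val]
      simp only [Matrix.mul_apply, Fin.sum_univ_two, Matrix.of_apply, Matrix.cons_val_zero,
        Matrix.cons_val_one, map_add, map_mul, one_mul, map_neg, toZMod_teich]
      rw [hx]
      field_simp
      ring
    exact ⟨x, ⟨_, hI⟩, by rw [cosetRep_coe, mul_inv_cancel_left]⟩

/-- For `x ≠ 0`, the product `([y] 1; 1 0)([x] 1; 1 0)` lies in the coset of `y + x⁻¹`. -/
lemma exists_kap_mul_kap (y x : ZMod p) (hx : x ≠ 0) : ∃ h : I p,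
    kap p y * kap p x = kap p (y + x⁻¹) * h.1 ∧ PadicInt.toZMod (h.1.1 0 0) = x := by
  have hI : (kap p (y + x⁻¹))⁻¹ * (kap p y * kap p x) ∈ I p := by
    change PadicInt.toZMod ((((kap p (y + x⁻¹))⁻¹).1 * ((kap p y).1 * (kap p x).1)) 1 0) = 0
    rw [kap_inv_val, kap_val, kap_val]
    simp [toZMod_teich]
    field_simp
    ring
  refine ⟨⟨_, hI⟩, by rw [mul_inv_cancel_left], ?_⟩
  change PadicInt.toZMod ((((kap p (y + x⁻¹))⁻¹).1 * ((kap p y).1 * (kap p x).1)) 0 0) = x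
  rw [kap_inv_val, kap_val, kap_val]
  simp [toZMod_teich]

lemma exists_kap_mul_kap_zero (y : ZMod p) : ∃ h : I p,
    kap p y * kap p 0 = h.1 ∧ h.1.1 0 0 = 1 := by
  have hI : kap p y * kap p 0 ∈ I p := by
    change PadicInt.toZMod (((kap p y).1 * (kap p 0).1) 1 0) = 0
    rw [kap_val, kap_val]
    simp [teich_zero]
  refine ⟨⟨_, hI⟩, rfl, ?_⟩
  change ((kap p y).1 * (kap p 0).1) 0 0 = 1
  rw [kap_val, kap_val]
  simp [teich_zero]

end Matrices

/-! ### The vectors `κ X^r` of `V_r` and `κ [[β, 1]]` of `ind_{IZ}^G d^r` -/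

section Vectors

variable (p : ℕ) [Fact p.Prime] (k : Type*) [Field k] [Algebra (ZMod p) k] (r : ℕ)

/-- The monomial `X^j Y^(r-j)` of `V_r`, for `j ≤ r`. -/
def symMono (j : Fin (r + 1)) : Sym k r :=
  ⟨MvPolynomial.X 0 ^ (j : ℕ) * MvPolynomial.X 1 ^ (r - j), by
    rw [MvPolynomial.mem_homogeneousSubmodule]
    have h := (MvPolynomial.isHomogeneous_X_pow (R := k) (0 : Fin 2) j).mul
      (MvPolynomial.isHomogeneous_X_pow (R := k) (1 : Fin 2) (r - j))
    rwa [Nat.add_sub_cancel' (Nat.lt_succ_iff.1 j.2)] at h⟩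

/-- The vector `X^r` of `V_r`. -/
def xPow : Sym k r := ⟨MvPolynomial.X 0 ^ r, MvPolynomial.isHomogeneous_X_pow _ _⟩

/-- The vector `κ X^r` of `V_r`, for `κ ∈ K`. -/
def symVec (κ : K p) : Sym k r := symAct r ((redk p k).mapMatrix κ.1) (xPow k r)

/-- The vector `κ [[β, 1]]` of `ind_{IZ}^G d^r`, for `κ ∈ K`. -/
def iwVec (κ : K p) : CInd (IZ p) (dChar p k r) :=
  bracket (IZ p) (dChar p k r) (KtoG p κ * beta p) 1

lemma symAct_xPow (M : Matrix (Fin 2) (Fin 2) k) : (symAct r M (xPow k r)).1 =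
    (MvPolynomial.C (M 0 0) * MvPolynomial.X 0 + MvPolynomial.C (M 1 0) * MvPolynomial.X 1) ^ r := by
  change subst M (MvPolynomial.X 0 ^ r) = _
  rw [map_pow, subst, MvPolynomial.aeval_X, Fin.sum_univ_two]

lemma symAct_symVec (κ κ' : K p) :
    symAct r ((redk p k).mapMatrix κ.1) (symVec p k r κ') = symVec p k r (κ * κ') := by
  rw [symVec, symAct_symAct, ← map_mul]
  rfl

lemma symVec_one : symVec p k r 1 = xPow k r := by
  rw [symVec, Units.val_one, map_one, map_one]
  rfl

lemma symVec_I (h : I p) : symVec p k r h.1 = redk p k (h.1.1 0 0) ^ r • xPow k r := by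
  refine Subtype.ext ?_
  rw [symVec, symAct_xPow]
  have h0 : redk p k (h.1.1 1 0) = 0 := by
    rw [redk, RingHom.comp_apply, show PadicInt.toZMod (h.1.1 1 0) = 0 from h.2, map_zero]
  change (MvPolynomial.C (redk p k (h.1.1 0 0)) * MvPolynomial.X 0 +
    MvPolynomial.C (redk p k (h.1.1 1 0)) * MvPolynomial.X 1) ^ r =
      redk p k (h.1.1 0 0) ^ r • MvPolynomial.X 0 ^ r
  rw [h0, map_zero, zero_mul, add_zero, mul_pow, ← map_pow, MvPolynomial.smul_eq_C_mul]

lemma symVec_mul_I (κ : K p) (h : I p) :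
    symVec p k r (κ * h.1) = redk p k (h.1.1 0 0) ^ r • symVec p k r κ := by
  rw [← symAct_symVec, symVec_I, map_smul]
  rfl

lemma iwVec_mul_I (κ : K p) (h : I p) :
    iwVec p k r (κ * h.1) = redk p k (h.1.1 0 0) ^ r • iwVec p k r κ := by
  obtain ⟨h', e, -, e'⟩ := exists_conj_beta p h
  have e2 : KtoG p (κ * h.1) * beta p = KtoG p κ * beta p * IpToG p (h', 1) := by
    rw [map_mul, mul_assoc, KtoG_mul_beta p e, ← mul_assoc]
    simp [IpToG, KpToG]
  rw [iwVec, e2, bracket_mul (h := ⟨IpToG p (h', 1), mem_IZ p _⟩), dChar_apply, iwVec,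
    ← map_smul, e']
  rfl

lemma cInd_iwVec (κ κ' : K p) : cInd (IZ p) (dChar p k r) (KtoG p κ) (iwVec p k r κ') =
    iwVec p k r (κ * κ') := by
  rw [iwVec, cInd_bracket, iwVec, map_mul, mul_assoc]

lemma bracket_mul_pScalar_zpow (n : ℤ) (g : G p) (v : k) :
    bracket (IZ p) (dChar p k r) (pScalar p ^ n * g) v = bracket (IZ p) (dChar p k r) g v := by
  have e : pScalar p ^ n * g = g * IpToG p (1, Multiplicative.ofAdd n) := by
    rw [pScalar_zpow_comm]
    simp [IpToG, KpToG]
  rw [e, bracket_mul (h := ⟨IpToG p _, mem_IZ p _⟩), dChar_apply]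
  simp

lemma symBracket_mul_pScalar_zpow (n : ℤ) (g : G p) (P : Sym k r) :
    bracket (KZ p) (symRep p k r) (pScalar p ^ n * g) P = bracket (KZ p) (symRep p k r) g P := by
  have e : pScalar p ^ n * g = g * KpToG p (1, Multiplicative.ofAdd n) := by
    rw [pScalar_zpow_comm]
    simp [KpToG]
  rw [e, bracket_mul (h := ⟨KpToG p _, mem_KZ p _⟩), symRep_apply]
  simp

lemma symBracket_mul_K (g : G p) (κ : K p) (P : Sym k r) :
    bracket (KZ p) (symRep p k r) (g * KtoG p κ) P =
      bracket (KZ p) (symRep p k r) g (symAct r ((redk p k).mapMatrix κ.1) P) := by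
  have e : KtoG p κ = KpToG p (κ, 1) := by simp [KpToG]
  rw [e, bracket_mul (h := ⟨KpToG p _, mem_KZ p _⟩), symRep_apply]

end Vectors

/-! ### The relations among the vectors `κ X^r` -/

section Relations

variable (p : ℕ) [Fact p.Prime] (k : Type*) [Field k] [Algebra (ZMod p) k] (r : ℕ)

lemma symVec_one_eq : symVec p k r 1 = symMono k r (Fin.last r) := by
  rw [symVec_one]
  refine Subtype.ext ?_
  simp [xPow, symMono]

lemma symVec_kap (x : ZMod p) : symVec p k r (kap p x) =
    ∑ j : Fin (r + 1), (algebraMap (ZMod p) k x ^ (j : ℕ) * (r.choose j : k)) • symMono k r j := by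
  refine Subtype.ext ?_
  rw [symVec, symAct_xPow]
  have e : ∀ a : Fin (r + 1) → k, (∑ j, a j • symMono k r j).1 = ∑ j, a j • (symMono k r j).1 :=
    fun a => map_sum (MvPolynomial.homogeneousSubmodule (Fin 2) k r).subtype _ _
  rw [e]
  change (MvPolynomial.C (redk p k (teich p x)) * MvPolynomial.X 0 +
    MvPolynomial.C (redk p k 1) * MvPolynomial.X 1) ^ r = _
  rw [redk, RingHom.comp_apply, toZMod_teich, map_one, map_one, one_mul, add_pow,
    Finset.sum_range]
  refine Finset.sum_congr rfl fun j _ => ?_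
  simp only [symMono, MvPolynomial.smul_eq_C_mul, map_mul, map_pow, map_natCast]
  ring

lemma symMono_coeff (j j' : Fin (r + 1)) :
    MvPolynomial.coeff (Finsupp.single 0 (j : ℕ) + Finsupp.single 1 (r - j))
      (symMono k r j').1 = if j = j' then 1 else 0 := by
  have e : (symMono k r j').1 =
      MvPolynomial.monomial (Finsupp.single 0 (j' : ℕ) + Finsupp.single 1 (r - j')) 1 := by
    change MvPolynomial.X 0 ^ (j' : ℕ) * MvPolynomial.X 1 ^ (r - j') = _
    rw [MvPolynomial.X_pow_eq_monomial, MvPolynomial.X_pow_eq_monomial,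
      MvPolynomial.monomial_mul, one_mul]
  rw [e, MvPolynomial.coeff_monomial]
  refine if_congr ⟨fun h => ?_, fun h => by rw [h]⟩ rfl rfl
  have := DFunLike.congr_fun h 0
  simp only [Finsupp.add_apply, Finsupp.single_eq_same] at this
  rw [Finsupp.single_eq_of_ne (by decide), Finsupp.single_eq_of_ne (by decide)] at this
  exact Fin.ext (by omega)

lemma linearIndependent_symMono : LinearIndependent k (symMono k r) := by
  rw [Fintype.linearIndependent_iff]
  intro a ha j
  have h := congrArg (fun P : Sym k r =>
    MvPolynomial.coeff (Finsupp.single 0 (j : ℕ) + Finsupp.single 1 (r - j)) P.1) ha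
  have e : (∑ j, a j • symMono k r j).1 = ∑ j, a j • (symMono k r j).1 :=
    map_sum (MvPolynomial.homogeneousSubmodule (Fin 2) k r).subtype _ _
  simp only [e, MvPolynomial.coeff_sum, MvPolynomial.coeff_smul, symMono_coeff, smul_eq_mul,
    mul_ite, mul_one, mul_zero, Finset.sum_ite_eq, Finset.mem_univ, if_true] at h
  exact h

lemma exists_sum_symMono (P : Sym k r) : ∃ a : Fin (r + 1) → k, P = ∑ j, a j • symMono k r j := by
  refine ⟨fun j => MvPolynomial.coeff (Finsupp.single 0 (j : ℕ) + Finsupp.single 1 (r - j)) P.1,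
    Subtype.ext ?_⟩
  have e : ∀ a : Fin (r + 1) → k, (∑ j, a j • symMono k r j).1 = ∑ j, a j • (symMono k r j).1 :=
    fun a => map_sum (MvPolynomial.homogeneousSubmodule (Fin 2) k r).subtype _ _
  rw [e]
  ext d
  by_cases hd : d 0 + d 1 = r
  · obtain ⟨j, rfl⟩ : ∃ j : Fin (r + 1),
        d = Finsupp.single 0 (j : ℕ) + Finsupp.single 1 (r - j) := by
      refine ⟨⟨d 0, by omega⟩, ?_⟩
      ext i
      fin_cases i
      · simp
      · simp
        omega
    simp only [MvPolynomial.coeff_sum, MvPolynomial.coeff_smul, symMono_coeff, smul_eq_mul,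
      mul_ite, mul_one, mul_zero, Finset.sum_ite_eq, Finset.mem_univ, if_true]
  · have h0 : ∀ Q : Sym k r, MvPolynomial.coeff d Q.1 = 0 := by
      intro Q
      refine (show Q.1.IsHomogeneous r from Q.2).coeff_eq_zero ?_
      rwa [Finsupp.degree_eq_sum, Fin.sum_univ_two]
    simp [MvPolynomial.coeff_sum, h0]

/-- A combination of the vectors `κ X^r`, `κ ∈ K / I`, expanded in monomials. -/
lemma sum_symVec (c : ZMod p → k) (c' : k) :
    c' • symVec p k r 1 + ∑ x, c x • symVec p k r (kap p x) = ∑ j : Fin (r + 1),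
      ((∑ x, c x * algebraMap (ZMod p) k x ^ (j : ℕ)) * (r.choose j : k) +
        if (j : ℕ) = r then c' else 0) • symMono k r j := by
  simp only [symVec_kap, Finset.smul_sum, smul_smul]
  rw [Finset.sum_comm]
  simp only [add_smul, Finset.sum_add_distrib, Finset.sum_mul, Finset.sum_smul, mul_assoc]
  rw [add_comm]
  congr 1
  rw [Finset.sum_eq_single (Fin.last r), symVec_one_eq]
  · simp
  · intro j _ hj
    rw [if_neg (fun h => hj (Fin.ext (by simpa using h))), zero_smul]
  · simp

variable {r}

/-- The vectors `κ X^r` span `V_r`. -/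
lemma exists_sum_symVec (hr : r ≤ p - 1) (P : Sym k r) :
    ∃ c : ZMod p → k, P = ∑ x, c x • symVec p k r (kap p x) := by
  have hp := (Fact.out : p.Prime).two_le
  obtain ⟨a, rfl⟩ := exists_sum_symMono k r P
  obtain ⟨c, hc⟩ := exists_moments p
    (fun j => if h : j < r + 1 then a ⟨j, h⟩ / (r.choose j : k) else 0)
  refine ⟨c, ?_⟩
  have h := sum_symVec p k r c 0
  rw [zero_smul, zero_add] at h
  rw [h]
  refine Finset.sum_congr rfl fun j _ => ?_
  rw [hc j (by omega), dif_pos j.2, div_mul_cancel₀ _ (choose_ne_zero p hr (by omega))]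
  simp

lemma moments_of_sum_symVec_eq_zero (hr : r ≤ p - 1) (c : ZMod p → k) (c' : k)
    (h : c' • symVec p k r 1 + ∑ x, c x • symVec p k r (kap p x) = 0) (j : ℕ) (hj : j ≤ r) :
    ∑ x, c x * algebraMap (ZMod p) k x ^ j + (if j = r then c' else 0) = 0 := by
  rw [sum_symVec] at h
  have h1 := Fintype.linearIndependent_iff.1 (linearIndependent_symMono k r) _ h
    ⟨j, Nat.lt_succ_of_le hj⟩
  simp only at h1
  split_ifs at h1 ⊢ with h2
  · rwa [h2, Nat.choose_self, Nat.cast_one, mul_one, ← h2] at h1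
  · rw [add_zero] at h1 ⊢
    exact (mul_eq_zero.1 h1).resolve_right (choose_ne_zero p hr hj)

lemma sum_symVec_eq_zero (hr : r ≤ p - 1) :
    (if r = p - 1 then 1 else 0 : k) • symVec p k r 1 + ∑ x, symVec p k r (kap p x) = 0 := by
  have hp := (Fact.out : p.Prime).two_le
  have h := sum_symVec p k r (fun _ => 1) (if r = p - 1 then 1 else 0)
  simp only [one_smul, one_mul] at h
  rw [h]
  refine Finset.sum_eq_zero fun j _ => ?_
  have hs := sum_algebraMap_pow_add p (k := k) (i := 0) (j := j) (by omega) (by omega)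
  rw [zero_add, if_neg (by omega : ¬ (0 = p - 1 ∧ (j : ℕ) = p - 1)), add_zero] at hs
  rw [hs]
  by_cases h1 : (j : ℕ) = r
  · by_cases h2 : r = p - 1
    · rw [if_pos (by omega), if_pos h1, if_pos h2, h1, Nat.choose_self]
      simp
    · rw [if_neg (by omega), if_pos h1, if_neg h2]
      simp
  · rw [if_neg (by omega), if_neg h1]
    simp

/-- For a function `F` on `K` transforming under `I` on the right by the character `a^r`, the
translate by `([y] 1; 1 0)` of `∑ₓ F([x] 1; 1 0) + δ_{r,p-1} F(1)`, in terms of the values of `F` at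
the coset representatives. -/
lemma sum_kap_mul {M : Type*} [AddCommGroup M] [Module k M] (hr : r ≤ p - 1) (F : K p → M)
    (hF : ∀ (κ : K p) (h : I p), F (κ * h.1) = redk p k (h.1.1 0 0) ^ r • F κ) (y : ZMod p) :
    (if r = p - 1 then 1 else 0 : k) • F (kap p y) + ∑ x, F (kap p y * kap p x) =
      F 1 + ∑ z, algebraMap (ZMod p) k (z - y) ^ (p - 1 - r) • F (kap p z) := by
  have hp := (Fact.out : p.Prime).two_le
  have h1 : ∀ x : ZMod p, F (kap p y * kap p x) =
      algebraMap (ZMod p) k x⁻¹ ^ (p - 1 - r) • F (kap p (y + x⁻¹)) +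
        if x = 0 then F 1 - (if r = p - 1 then 1 else 0 : k) • F (kap p y) else 0 := by
    intro x
    by_cases hx : x = 0
    · obtain ⟨h, e, e1⟩ := exists_kap_mul_kap_zero p y
      rw [if_pos hx, hx, e, ← one_mul h.1, hF, e1, map_one, one_pow, one_smul, inv_zero, add_zero, map_zero]
      by_cases h2 : r = p - 1
      · rw [if_pos h2, h2, Nat.sub_self, pow_zero, one_smul]
        abel
      · rw [if_neg h2, zero_pow (by omega), zero_smul]
        abel
    · obtain ⟨h, e, e1⟩ := exists_kap_mul_kap p y x hx
      rw [if_neg hx, e, hF, redk, RingHom.comp_apply, e1, add_zero]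
      congr 1
      rw [← map_pow, ← map_pow]
      congr 1
      have h2 : x ^ (p - 1 - r) * x ^ r = 1 := by
        rw [← pow_add, Nat.sub_add_cancel hr, ZMod.pow_card_sub_one_eq_one hx]
      rw [inv_pow]
      exact eq_inv_of_mul_eq_one_right h2
  have h3 : ∑ z, algebraMap (ZMod p) k (z - y) ^ (p - 1 - r) • F (kap p z) =
      ∑ x : ZMod p, algebraMap (ZMod p) k x⁻¹ ^ (p - 1 - r) • F (kap p (y + x⁻¹)) := by
    refine (Fintype.sum_equiv ((Equiv.inv (ZMod p)).trans (Equiv.addLeft y)) _ _ fun x => ?_).symm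
    simp
  rw [Finset.sum_congr rfl fun x _ => h1 x, Finset.sum_add_distrib, Finset.sum_ite_eq',
    if_pos (Finset.mem_univ _), h3]
  abel

end Relations

/-! ### The comparison map `ind_{IZ}^G d^r → ind_{KZ}^G V_r` -/

section Comparison

variable (p : ℕ) [Fact p.Prime] (k : Type*) [Field k] [Algebra (ZMod p) k] (r : ℕ)

/-- The map `v ↦ [β, v X^r]`. -/
def betaXPow : k →ₗ[k] CInd (KZ p) (symRep p k r) :=
  bracket (KZ p) (symRep p k r) (beta p) ∘ₗ LinearMap.toSpanSingleton k _ (xPow k r)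

lemma betaXPow_apply (v : k) :
    betaXPow p k r v = bracket (KZ p) (symRep p k r) (beta p) (v • xPow k r) := rfl

lemma betaXPow_equivariant (h : IZ p) (v : k) :
    betaXPow p k r (dChar p k r h v) = cInd (KZ p) (symRep p k r) h (betaXPow p k r v) := by
  obtain ⟨_, ⟨⟨h, n⟩, rfl⟩⟩ := h
  obtain ⟨h', e, e', -⟩ := exists_conj_beta p h
  rw [dChar_apply, betaXPow_apply, betaXPow_apply, cInd_bracket]
  have e2 : IpToG p (h, n) * beta p = pScalar p ^ n.toAdd * (beta p * KtoG p h'.1) := by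
    rw [← KtoG_mul_beta p e, ← mul_assoc]
    rfl
  change _ = bracket (KZ p) (symRep p k r) (IpToG p (h, n) * beta p) (v • xPow k r)
  rw [e2, symBracket_mul_pScalar_zpow, symBracket_mul_K, map_smul (symAct r _)]
  change _ = bracket (KZ p) (symRep p k r) (beta p) (v • symVec p k r h'.1)
  rw [symVec_I, e', smul_smul, mul_comm]

/-- The `G`-equivariant map `ind_{IZ}^G d^r → ind_{KZ}^G V_r` sending `[[1, 1]]` to `[β, X^r]`. -/
def psi : (cInd (IZ p) (dChar p k r)).IntertwiningMap (cInd (KZ p) (symRep p k r)) :=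
  frob (cInd (KZ p) (symRep p k r)) (betaXPow p k r) (betaXPow_equivariant p k r)

lemma psi_bracket (g : G p) (v : k) : psi p k r (bracket (IZ p) (dChar p k r) g v) =
    bracket (KZ p) (symRep p k r) (g * beta p) (v • xPow k r) := by
  rw [psi, frob_bracket, betaXPow_apply, cInd_bracket]

lemma symBracket_mul_beta_mul_beta (g : G p) (P : Sym k r) :
    bracket (KZ p) (symRep p k r) (g * beta p * beta p) P =
      bracket (KZ p) (symRep p k r) g P := by
  rw [mul_assoc, beta_mul_beta, ← zpow_one (pScalar p), ← pScalar_zpow_comm,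
    symBracket_mul_pScalar_zpow]

lemma psi_bracket_mul_beta (g : G p) (v : k) :
    psi p k r (bracket (IZ p) (dChar p k r) (g * beta p) v) =
      bracket (KZ p) (symRep p k r) g (v • xPow k r) := by
  rw [psi_bracket, symBracket_mul_beta_mul_beta]

lemma psi_iwVec (κ : K p) :
    psi p k r (iwVec p k r κ) = bracket (KZ p) (symRep p k r) 1 (symVec p k r κ) := by
  rw [iwVec, psi_bracket_mul_beta, one_smul]
  have := symBracket_mul_K p k r 1 κ (xPow k r)
  rwa [one_mul] at this

/-- The operator `T_{-1,0} + δ_{r,p-1} T_{1,0}`. -/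
def opN :
    (cInd (IZ p) (dChar p k r)).IntertwiningMap (cInd (IZ p) (dChar p k r)) :=
  Tm10 p k r + (if r = p - 1 then 1 else 0 : k) • T10 p k r

/-- The operator `T_{1,2} + δ_{r,0} T_{1,0}`. -/
def opS :
    (cInd (IZ p) (dChar p k r)).IntertwiningMap (cInd (IZ p) (dChar p k r)) :=
  T12 p k r + (if r = 0 then 1 else 0 : k) • T10 p k r

variable {r}

lemma psi_surjective (hr : r ≤ p - 1) : Function.Surjective (psi p k r) := by
  intro f
  refine mem_of_bracket_mem (LinearMap.range (psi p k r).toLinearMap) (fun g P => ?_) f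
  obtain ⟨c, rfl⟩ := exists_sum_symVec p k hr P
  refine ⟨cInd _ _ g (∑ x, c x • iwVec p k r (kap p x)), ?_⟩
  change psi p k r (cInd _ _ g (∑ x, c x • iwVec p k r (kap p x))) = _
  rw [(psi p k r).isIntertwining, map_sum]
  simp only [map_smul, psi_iwVec]
  simp only [← map_smul, ← map_sum]
  rw [cInd_bracket, mul_one]

lemma T10_bracket_one (hr : (p - 1) ∣ r) (v : k) :
    T10 p k r (bracket (IZ p) (dChar p k r) 1 v) = bracket (IZ p) (dChar p k r) (beta p) v := by
  rw [T10, dif_pos hr, frob_bracket, cInd_bracket, one_mul]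

lemma ite_smul_T10_bracket_one (q : Prop) [Decidable q] (hq : q → (p - 1) ∣ r) (v : k) :
    (if q then 1 else 0 : k) • T10 p k r (bracket (IZ p) (dChar p k r) 1 v) =
      (if q then 1 else 0 : k) • bracket (IZ p) (dChar p k r) (beta p) v := by
  split_ifs with h
  · rw [T10_bracket_one p k (hq h)]
  · rw [zero_smul, zero_smul]

lemma opN_bracket_one (v : k) : opN p k r (bracket (IZ p) (dChar p k r) 1 v) =
    ∑ x, bracket (IZ p) (dChar p k r) (KtoG p (kap p x) * beta p) v +
      (if r = p - 1 then 1 else 0 : k) • bracket (IZ p) (dChar p k r) (beta p) v := by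
  change Tm10 p k r _ + (if r = p - 1 then 1 else 0 : k) • T10 p k r _ = _
  rw [ite_smul_T10_bracket_one p k _ (fun h => h ▸ dvd_rfl), Tm10, frob_bracket, map_one]
  simp only [← up_eq]
  rw [Module.End.one_apply, upVec, LinearMap.sum_apply]

lemma opS_bracket_one (v : k) : opS p k r (bracket (IZ p) (dChar p k r) 1 v) =
    ∑ x, bracket (IZ p) (dChar p k r) (beta p * KtoG p (kap p x)) v +
      (if r = 0 then 1 else 0 : k) • bracket (IZ p) (dChar p k r) (beta p) v := by
  change T12 p k r _ + (if r = 0 then 1 else 0 : k) • T10 p k r _ = _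
  rw [ite_smul_T10_bracket_one p k _ (fun h => h ▸ dvd_zero _), T12, frob_bracket, map_one]
  simp only [← low_eq]
  rw [Module.End.one_apply, lowVec, LinearMap.sum_apply]

/-- The comparison map kills the image of `T_{-1,0} + δ_{r,p-1} T_{1,0}`, because
`∑ₓ (x X + Y)^r + δ_{r,p-1} X^r = 0` for `r ≤ p - 1`. -/
lemma psi_opN (hr : r ≤ p - 1) (f : CInd (IZ p) (dChar p k r)) :
    psi p k r (opN p k r f) = 0 := by
  refine cInd_hom_ext (A := (psi p k r).comp (opN p k r)) (B := 0) (fun v => ?_) f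
  change psi p k r (opN p k r _) = 0
  have hv : bracket (IZ p) (dChar p k r) 1 v = v • bracket (IZ p) (dChar p k r) 1 1 := by
    rw [← map_smul, smul_eq_mul, mul_one]
  have h1 : bracket (IZ p) (dChar p k r) (beta p) 1 = iwVec p k r 1 := by
    rw [iwVec, map_one (KtoG p), one_mul]
  rw [hv, map_smul, map_smul, opN_bracket_one, h1]
  change v • psi p k r (∑ x, iwVec p k r (kap p x) + _) = 0
  rw [map_add, map_sum, map_smul]
  simp only [psi_iwVec]
  rw [← map_smul, ← map_sum, ← map_add, add_comm, sum_symVec_eq_zero p k hr, map_zero, smul_zero]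

lemma symAct_zero_xPow (y : k) :
    symAct r !![(p : k), 0; 0, y] (xPow k r) = (if r = 0 then 1 else 0 : k) • xPow k r := by
  have hp : (p : k) = 0 := by
    rw [← map_natCast (algebraMap (ZMod p) k), CharP.cast_eq_zero, map_zero]
  refine Subtype.ext ?_
  rw [symAct_xPow]
  change _ = (if r = 0 then 1 else 0 : k) • (MvPolynomial.X 0 : MvPolynomial (Fin 2) k) ^ r
  by_cases h : r = 0
  · simp [h]
  · simp [h, hp]

/-- The comparison map intertwines `T_{1,2} + δ_{r,0} T_{1,0}` with the Hecke operator `T`. -/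
lemma psi_opS (f : CInd (IZ p) (dChar p k r)) :
    psi p k r (opS p k r f) = T p k r (psi p k r f) := by
  refine cInd_hom_ext (A := (psi p k r).comp (opS p k r)) (B := (T p k r).comp (psi p k r))
    (fun v => ?_) f
  change psi p k r (opS p k r _) = T p k r (psi p k r _)
  rw [opS_bracket_one, psi_bracket, one_mul, T, frob_bracket, heckeVec, map_add, map_smul, map_sum,
    LinearMap.add_apply, LinearMap.sum_apply, map_add, map_sum]
  congr 1
  · refine Finset.sum_congr rfl fun x _ => ?_
    rw [psi_bracket, LinearMap.comp_apply, cInd_bracket, up_eq, ← mul_assoc]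
    refine congrArg _ ?_
    rw [map_smul (symAct r _)]
    refine congrArg (v • ·) (Subtype.ext ?_)
    rw [symAct_xPow]
    simp [xPow]
  · rw [psi_bracket, LinearMap.comp_apply, cInd_bracket, alpha_eq, map_smul (symAct r _),
      symAct_zero_xPow, ← map_smul, ← mul_assoc, symBracket_mul_K]
    congr 1
    rw [map_smul, map_smul, smul_comm]
    congr 1
    by_cases h : r = 0
    · subst h
      congr 1
      refine Subtype.ext ?_
      rw [symAct_xPow]
      simp [xPow]
    · rw [if_neg h, zero_smul, zero_smul]

/-! ### The kernel of the comparison map -/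

lemma relation_mem_range_opN (hr : r ≤ p - 1) (y : ZMod p) :
    iwVec p k r 1 + ∑ z, algebraMap (ZMod p) k (z - y) ^ (p - 1 - r) • iwVec p k r (kap p z) ∈
      (opN p k r).range := by
  rw [← sum_kap_mul p k hr (iwVec p k r) (iwVec_mul_I p k r) y]
  have e : opN p k r (cInd _ _ (KtoG p (kap p y)) (bracket (IZ p) (dChar p k r) 1 1)) =
      (if r = p - 1 then 1 else 0 : k) • iwVec p k r (kap p y) +
        ∑ x, iwVec p k r (kap p y * kap p x) := by
    rw [(opN p k r).isIntertwining, opN_bracket_one, map_add, map_smul, map_sum, add_comm,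
      cInd_bracket]
    simp only [← cInd_iwVec p k r (kap p y)]
    rfl
  exact ⟨_, e⟩

/-- Every relation among the vectors `κ X^r` of `V_r` holds among the vectors `κ [[β, 1]]` modulo
the image of `T_{-1,0} + δ_{r,p-1} T_{1,0}`. -/
lemma sum_iwVec_mem_range_opN (hr : r ≤ p - 1) (c : ZMod p → k) (c' : k)
    (h : c' • symVec p k r 1 + ∑ x, c x • symVec p k r (kap p x) = 0) :
    c' • iwVec p k r 1 + ∑ x, c x • iwVec p k r (kap p x) ∈ (opN p k r).range.toSubmodule := by
  obtain ⟨d, h1, h2⟩ :=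
    exists_combination_of_moments p hr c c' (moments_of_sum_symVec_eq_zero p k hr c c' h)
  have e : c' • iwVec p k r 1 + ∑ x, c x • iwVec p k r (kap p x) =
      ∑ y, d y • (iwVec p k r 1 +
        ∑ z, algebraMap (ZMod p) k (z - y) ^ (p - 1 - r) • iwVec p k r (kap p z)) := by
    simp only [smul_add, Finset.sum_add_distrib, Finset.smul_sum, smul_smul]
    rw [h1, Finset.sum_smul, Finset.sum_comm]
    simp only [h2, Finset.sum_smul]
  rw [e]
  exact Submodule.sum_mem _ fun y _ => Submodule.smul_mem _ _ (relation_mem_range_opN p k hr y)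

/-- There is a linear map from `V_r` to the quotient of `ind_{IZ}^G d^r` by the image of
`T_{-1,0} + δ_{r,p-1} T_{1,0}` sending `κ X^r` to the class of `κ [[β, 1]]` for all `κ ∈ K`. -/
lemma exists_map_symVec (hr : r ≤ p - 1) :
    ∃ φ : Sym k r →ₗ[k] (CInd (IZ p) (dChar p k r) ⧸ (opN p k r).range.toSubmodule),
      ∀ κ : K p, φ (symVec p k r κ) = Submodule.Quotient.mk (iwVec p k r κ) := by
  classical
  let q : (OnePoint (ZMod p) → k) →ₗ[k] Sym k r :=
    Fintype.linearCombination k fun x => symVec p k r (cosetRep p x)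
  let s : (OnePoint (ZMod p) → k) →ₗ[k] CInd (IZ p) (dChar p k r) :=
    Fintype.linearCombination k fun x => iwVec p k r (cosetRep p x)
  have hq : ∀ c, q c = c OnePoint.infty • symVec p k r 1 +
      ∑ x : ZMod p, c x • symVec p k r (kap p x) := fun c => by
    rw [Fintype.linearCombination_apply, sum_onePoint]
    rfl
  have hs : ∀ c, s c = c OnePoint.infty • iwVec p k r 1 +
      ∑ x : ZMod p, c x • iwVec p k r (kap p x) := fun c => by
    rw [Fintype.linearCombination_apply, sum_onePoint]
    rfl
  have hsurj : LinearMap.range q = ⊤ := by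
    rw [LinearMap.range_eq_top]
    intro P
    obtain ⟨c, rfl⟩ := exists_sum_symVec p k hr P
    refine ⟨fun x => x.elim 0 c, ?_⟩
    rw [hq]
    simp [OnePoint.elim_infty]
  -- Define the map on `V_r` by lifting along the surjection `q`; since the relations lie in the
  -- submodule divided out, the choice of lifts does not matter.
  obtain ⟨g, hg⟩ := q.exists_rightInverse_of_surjective hsurj
  refine ⟨(opN p k r).range.toSubmodule.mkQ ∘ₗ s ∘ₗ g, fun κ => ?_⟩
  obtain ⟨x, h, rfl⟩ := exists_cosetRep_mul p κ
  rw [symVec_mul_I, iwVec_mul_I, map_smul, Submodule.Quotient.mk_smul]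
  congr 1
  have hqx : q (Pi.single x 1) = symVec p k r (cosetRep p x) := by
    rw [Fintype.linearCombination_apply_single, one_smul]
  have hsx : s (Pi.single x 1) = iwVec p k r (cosetRep p x) := by
    rw [Fintype.linearCombination_apply_single, one_smul]
  change Submodule.Quotient.mk (s (g (symVec p k r (cosetRep p x)))) = _
  rw [Submodule.Quotient.eq, ← hsx, ← map_sub, hs]
  refine sum_iwVec_mem_range_opN p k hr (fun z => (g (symVec p k r (cosetRep p x)) - Pi.single x 1 :
    OnePoint (ZMod p) → k) z) _ ?_
  rw [← hq, map_sub, hqx, sub_eq_zero]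
  exact LinearMap.congr_fun hg _

/-- The kernel of the comparison map is the image of `T_{-1,0} + δ_{r,p-1} T_{1,0}`: by Frobenius
reciprocity, `V_r` mapping to the quotient by that image, the quotient map factors through the
comparison map. -/
lemma mem_range_opN_of_psi_eq_zero (hr : r ≤ p - 1) (f : CInd (IZ p) (dChar p k r))
    (hf : psi p k r f = 0) : f ∈ (opN p k r).range := by
  obtain ⟨φ, hφ⟩ := exists_map_symVec p k hr
  let Q := quotRep (opN p k r).range
  have hQ : ∀ (g : G p) v, Q g (Submodule.Quotient.mk v) =
      Submodule.Quotient.mk (cInd (IZ p) (dChar p k r) g v) := fun g v => rfl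
  have hequiv : ∀ (h : KZ p) (P : Sym k r), φ (symRep p k r h P) = Q h (φ P) := by
    rintro ⟨_, ⟨⟨κ, n⟩, rfl⟩⟩ P
    obtain ⟨c, rfl⟩ := exists_sum_symVec p k hr P
    rw [symRep_apply]
    simp only [map_sum, map_smul, symAct_symVec, hφ, hQ]
    refine Finset.sum_congr rfl fun x _ => congrArg (fun v => c x • Submodule.Quotient.mk v) ?_
    rw [← cInd_iwVec, iwVec, cInd_bracket, cInd_bracket]
    change _ = bracket (IZ p) (dChar p k r)
      (pScalar p ^ n.toAdd * KtoG p κ * (KtoG p (kap p x) * beta p)) 1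
    rw [mul_assoc (pScalar p ^ n.toAdd), bracket_mul_pScalar_zpow]
  let mk : (cInd (IZ p) (dChar p k r)).IntertwiningMap Q :=
    { (opN p k r).range.toSubmodule.mkQ with isIntertwining' := fun g => rfl }
  -- Both sides send `[[1, 1]]` to its own class, because `β² = p` acts trivially.
  have key : ∀ f, frob Q φ hequiv (psi p k r f) = mk f := by
    refine cInd_hom_ext (A := (frob Q φ hequiv).comp (psi p k r)) (B := mk) fun v => ?_
    change frob Q φ hequiv (psi p k r _) = Submodule.Quotient.mk _
    rw [psi_bracket, frob_bracket, ← symVec_one (p := p), map_smul, hφ, map_smul, hQ, iwVec,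
      cInd_bracket, ← Submodule.Quotient.mk_smul, ← map_smul, map_one (KtoG p), one_mul,
      beta_mul_beta, smul_eq_mul, mul_one]
    have := bracket_mul_pScalar_zpow p k r 1 1 v
    rw [zpow_one, mul_one] at this
    rw [this]
  have h0 := key f
  rw [hf, map_zero] at h0
  exact (Submodule.Quotient.mk_eq_zero _).1 h0.symm

/-- The isomorphism `π(r, λ, η) ≅ Π(r, λ, η)`. -/
lemma nonempty_equiv_piRep_iwRep (hr : r ≤ p - 1) (l : k) (η : ℚ_[p]ˣ →* kˣ) :
    Nonempty ((piRep p k r l η).Equiv (iwRep p k r l η)) :=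
  nonempty_equiv_quotRep (psi p k r) (opN p k r) (opS p k r) (T p k r) l _
    (psi_surjective p k hr) (psi_opN p k hr) (mem_range_opN_of_psi_eq_zero p k hr)
    (psi_opS p k)

end Comparison

lemma cls_le (p : ℕ) [Fact p.Prime] (a : ℤ) : cls p a ≤ p - 1 := by
  have hp := (Fact.out : p.Prime).two_le
  have := Int.emod_lt_of_pos a (show (0 : ℤ) < (p : ℤ) - 1 by omega)
  rw [cls]
  omega

end ModpLLC

end

theorem mainTheorem1 (p : ℕ) [Fact p.Prime] {k : Type*} [Field k] [Algebra (ZMod p) k]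
    [IsAlgClosure (ZMod p) k] (red : ModpLLC.ZpBar p →+* k)
    (r : ℕ) (hr : r ≤ p - 1) (l : k) (η : ℚ_[p]ˣ →* kˣ) (hη : ModpLLC.IsSmoothChar η) :
    Nonempty ((ModpLLC.piRep p k r l η).Equiv (ModpLLC.iwRep p k r l η)) ∧
    ∀ {W : Type*} [AddCommGroup W] [Module k W] {U : Type*} [AddCommGroup U] [Module k U]
      (ρ : Representation k (ModpLLC.GalQp p) W) (P : Representation k (ModpLLC.G p) U),
      ModpLLC.BreuilLLC red r l η ρ P ↔ ModpLLC.IwahoriLLC red r l η ρ P := by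
  refine ⟨ModpLLC.nonempty_equiv_piRep_iwRep p k hr l η, fun ρ P => ?_⟩
  obtain ⟨e⟩ := ModpLLC.nonempty_equiv_piRep_iwRep p k hr l η
  obtain ⟨e₀⟩ := ModpLLC.nonempty_equiv_piRep_iwRep p k hr 0 η
  obtain ⟨e'⟩ := ModpLLC.nonempty_equiv_piRep_iwRep p k (ModpLLC.cls_le p (p - 3 - r)) l⁻¹
    (η * ModpLLC.omegaQp p k ^ (r + 1))
  refine and_congr_right fun _ => and_congr (imp_congr_right fun _ => ?_)
    (imp_congr_right fun _ => ?_)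
  · exact ⟨fun ⟨f⟩ => ⟨f.trans e₀⟩, fun ⟨f⟩ => ⟨f.trans e₀.symm⟩⟩
  · exact ⟨fun h => h.congr e e', fun h => h.congr e.symm e'.symm⟩
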